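/- Let $R$ be a principal ideal domain with field of fractions $K$, let $N\ge 1$, and let $\phi:\mathbb P^N\to\mathbb P^N$ be a morphism over $K$ of algebraic degree $d\ge 1$; that is, $\phi(x_0:\dots:x_N)=(\Phi_0(x):\dots:\Phi_N(x))$ for some $(N+1)$-tuple $\Phi=(\Phi_0,\dots,\Phi_N)$ of forms of degree $d$ over $K$ in $x_0,\dots,x_N$ which have no common zero in $\bar K^{N+1}\setminus\{0\}$. Such a $\Phi$ is called a homogeneous lift of $\phi$. For a field $L\supseteq K$, lifts over $L$ are defined in the same way (for $\phi$ regarded as a morphism over $L$), and a model of $\phi$ over $L$ is a tuple $A\circ\Phi\circ A^{-1}$ with $\Phi$ a homogeneous lift of $\phi$ over $L$ and $A\in\mathrm{GL}_{N+1}(L)$. Let $\mathrm{Res}(\Psi)$ be the resultant of an $(N+1)$-tuple $\Psi$ of forms of degree $d$ in $N+1$ variables. For a nonzero prime ideal $\mathfrak p$ of $R$, let $K_{\mathfrak p}$ be the completion of $K$ with respect to the $\mathfrak p$-adic valuation $\mathrm{ord}_{\mathfrak p}$, and let $R_{\mathfrak p}=\{a\in K_{\mathfrak p}:\mathrm{ord}_{\mathfrak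 p}(a)\ge 0\}$. A model of $\phi$ over $K_{\mathfrak p}$ is $\mathfrak p$-integral if its coefficients lie in $R_{\mathfrak p}$, and a $\mathfrak p$-integral model $\Psi$ is $\mathfrak p$-minimal if $\mathrm{ord}_{\mathfrak p}(\mathrm{Res}(\Psi))\le\mathrm{ord}_{\mathfrak p}(\mathrm{Res}(\Psi'))$ for every $\mathfrak p$-integral model $\Psi'$ of $\phi$ over $K_{\mathfrak p}$. Then $\phi$ has a model $\Psi$ over $K$ whose coefficients lie in $R$ and which is $\mathfrak p$-minimal for every nonzero prime ideal $\mathfrak p$ of $R$. -/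

import Mathlib

open MvPolynomial

noncomputable section

namespace GlobalMinimal

/-! ### The resultant of `N + 1` forms of degree `d` in `N + 1` variables -/

/-- The exponents of the monomials of degree `d` in `x_0, …, x_N`. -/
abbrev Mono (N d : ℕ) : Type :=
  ↥((Finset.univ : Finset (Fin (N + 1))).finsuppAntidiag d)

/-- The polynomial ring `ℤ[u]` in the coefficients `u_{i,α}` of `N + 1` generic forms of
degree `d` in `N + 1` variables. -/
abbrev CoeffRing (N d : ℕ) : Type := MvPolynomial (Fin (N + 1) × Mono N d) ℤ

/-- The generic forms `F_i = ∑_{|α| = d} u_{i,α} x^α`. -/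
def genericForm (N d : ℕ) (i : Fin (N + 1)) : MvPolynomial (Fin (N + 1)) (CoeffRing N d) :=
  ∑ α : Mono N d, monomial (α : Fin (N + 1) →₀ ℕ) (X (i, α))

/-- `f ∈ ℤ[u]` lies in the elimination ideal of the generic forms: some power of every variable
`x_i`, multiplied by `f`, lies in the ideal `(F_0, …, F_N)` of `ℤ[u][x_0, …, x_N]`. -/
def IsEliminant (N d : ℕ) (f : CoeffRing N d) : Prop :=
  ∃ m : ℕ, ∀ i : Fin (N + 1),
    C f * X i ^ m ∈ Ideal.span (Set.range (genericForm N d))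

/-- The values of the coefficients `u_{i,α}` on an `(N + 1)`-tuple `Φ` of polynomials. -/
def coeffs {S : Type*} [CommRing S] {N : ℕ} (d : ℕ)
    (Φ : Fin (N + 1) → MvPolynomial (Fin (N + 1)) S) (p : Fin (N + 1) × Mono N d) : S :=
  coeff (p.2 : Fin (N + 1) →₀ ℕ) (Φ p.1)

/-- `r ∈ ℤ[u]` is the (universal) resultant: the greatest common divisor of the elimination ideal
(this ideal is in fact principal and prime), with the sign fixed by the usual normalization
`Res(x_0^d, …, x_N^d) = 1`. -/
structure IsUniversalResultant (N d : ℕ) (r : CoeffRing N d) : Prop where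
  dvd_iff : ∀ s : CoeffRing N d, s ∣ r ↔ ∀ f, IsEliminant N d f → s ∣ f
  normalized : aeval (coeffs d fun i : Fin (N + 1) => (X i ^ d : MvPolynomial (Fin (N + 1)) ℤ)) r
    = 1

theorem exists_gcd_of_set {A : Type*} [CommRing A] [IsDomain A] [UniqueFactorizationMonoid A]
    [IsNoetherianRing A] (S : Set A) : ∃ r : A, ∀ s, s ∣ r ↔ ∀ f ∈ S, s ∣ f := by
  classical
  let _ : StrongNormalizationMonoid A := UniqueFactorizationMonoid.strongNormalizationMonoid
  let _ : NormalizedGCDMonoid A := UniqueFactorizationMonoid.toNormalizedGCDMonoid A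
  obtain ⟨t, ht⟩ := IsNoetherian.noetherian (Ideal.span S)
  refine ⟨t.gcd id, fun s => ?_⟩
  rw [Finset.dvd_gcd_iff]
  have key : ∀ U : Set A, (∀ f ∈ U, s ∣ f) ↔ Ideal.span U ≤ Ideal.span {s} := by
    intro U
    rw [Ideal.span_le]
    simp only [Set.subset_def, SetLike.mem_coe, Ideal.mem_span_singleton]
  rw [key S, ← ht]
  exact key (t : Set A)

theorem exists_eliminant (N d : ℕ) : ∃ f : CoeffRing N d, IsEliminant N d f ∧
    aeval (coeffs d fun i : Fin (N + 1) => (X i ^ d : MvPolynomial (Fin (N + 1)) ℤ)) f = 1 := by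
  classical
  -- every monomial of degree `(N + 1) * d` is divisible by some `x_i ^ d`
  have hdiv : ∀ μ : Mono N ((N + 1) * d), ∃ i, d ≤ (μ : Fin (N + 1) →₀ ℕ) i := by
    rintro ⟨μ, hμ⟩
    rw [Finset.mem_finsuppAntidiag] at hμ
    by_contra! h
    have h1 : (∑ i : Fin (N + 1), μ i) < ∑ _i : Fin (N + 1), d :=
      Finset.sum_lt_sum_of_nonempty Finset.univ_nonempty fun i _ => h i
    have h2 := hμ.1
    rw [h2] at h1
    simp at h1
  choose ι hι using hdiv
  let P : Mono N ((N + 1) * d) → MvPolynomial (Fin (N + 1)) (CoeffRing N d) := fun μ =>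
    monomial ((μ : Fin (N + 1) →₀ ℕ) - Finsupp.single (ι μ) d) 1 * genericForm N d (ι μ)
  let M : Matrix (Mono N ((N + 1) * d)) (Mono N ((N + 1) * d)) (CoeffRing N d) :=
    fun μ ν => coeff (ν : Fin (N + 1) →₀ ℕ) (P μ)
  have hgen : ∀ i, (genericForm N d i).IsHomogeneous d := by
    intro i
    refine IsHomogeneous.sum _ _ _ fun α _ => isHomogeneous_monomial _ ?_
    have := (Finset.mem_finsuppAntidiag.1 α.2).1
    rw [Finsupp.degree_eq_sum]
    exact this
  have hPhom : ∀ μ, (P μ).IsHomogeneous ((N + 1) * d) := by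
    intro μ
    have h1 := (Finset.mem_finsuppAntidiag.1 μ.2).1
    have h2 : ((μ : Fin (N + 1) →₀ ℕ) - Finsupp.single (ι μ) d).degree + d = (N + 1) * d := by
      have h3 : ((μ : Fin (N + 1) →₀ ℕ) - Finsupp.single (ι μ) d) + Finsupp.single (ι μ) d = μ :=
        tsub_add_cancel_of_le (by
          rw [Finsupp.single_le_iff]
          exact hι μ)
      have h4 := congrArg Finsupp.degree h3
      rw [map_add, Finsupp.degree_single] at h4
      rw [h4, Finsupp.degree_eq_sum]
      exact h1
    rw [← h2]
    exact (isHomogeneous_monomial _ rfl).mul (hgen _)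
  have hPsum : ∀ μ, P μ = ∑ ν : Mono N ((N + 1) * d),
      C (M μ ν) * monomial (ν : Fin (N + 1) →₀ ℕ) 1 := by
    intro μ
    refine MvPolynomial.ext _ _ fun γ => ?_
    simp only [coeff_sum, coeff_C_mul, coeff_monomial, mul_ite, mul_one, mul_zero, M]
    by_cases hγ : γ ∈ (Finset.univ : Finset (Fin (N + 1))).finsuppAntidiag ((N + 1) * d)
    · rw [Finset.sum_eq_single (⟨γ, hγ⟩ : Mono N ((N + 1) * d))]
      · simp
      · intro b _ hb
        rw [if_neg]
        intro h
        exact hb (Subtype.ext h)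
      · simp
    · rw [Finset.sum_eq_zero]
      · refine (hPhom μ).coeff_eq_zero fun h => hγ ?_
        rw [Finset.mem_finsuppAntidiag]
        refine ⟨?_, Finset.subset_univ _⟩
        rw [← h, Finsupp.degree_eq_sum]
      · intro ν _
        rw [if_neg]
        rintro rfl
        exact hγ ν.2
  refine ⟨M.det, ⟨(N + 1) * d, fun i => ?_⟩, ?_⟩
  · have hmem : Finsupp.single i ((N + 1) * d) ∈
        (Finset.univ : Finset (Fin (N + 1))).finsuppAntidiag ((N + 1) * d) := by
      rw [Finset.mem_finsuppAntidiag]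
      refine ⟨?_, Finset.subset_univ _⟩
      rw [← Finsupp.degree_eq_sum, Finsupp.degree_single]
    let l : Mono N ((N + 1) * d) := ⟨_, hmem⟩
    have h1 : C M.det * X i ^ ((N + 1) * d) =
        ∑ μ, C (M.adjugate l μ) * P μ := by
      simp_rw [hPsum, Finset.mul_sum]
      rw [Finset.sum_comm]
      simp_rw [← mul_assoc, ← C_mul, ← Finset.sum_mul, ← map_sum]
      have h2 : ∀ ν, ∑ μ, M.adjugate l μ * M μ ν = if l = ν then M.det else 0 := by
        intro ν
        rw [← Matrix.mul_apply, Matrix.adjugate_mul, Matrix.smul_apply, Matrix.one_apply]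
        simp
      simp_rw [h2]
      rw [Finset.sum_eq_single l]
      · simp [l, X_pow_eq_monomial]
      · intro b _ hb
        rw [if_neg (Ne.symm hb)]
        simp
      · simp
    rw [h1]
    refine Ideal.sum_mem _ fun μ _ => Ideal.mul_mem_left _ _ (Ideal.mul_mem_left _ _ ?_)
    exact Ideal.subset_span ⟨_, rfl⟩
  · set e := aeval (R := ℤ)
      (coeffs d fun i : Fin (N + 1) => (X i ^ d : MvPolynomial (Fin (N + 1)) ℤ)) with he
    have hF : ∀ i, MvPolynomial.map (e : CoeffRing N d →+* ℤ) (genericForm N d i) = X i ^ d := by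
      intro i
      have hmem : Finsupp.single i d ∈
          (Finset.univ : Finset (Fin (N + 1))).finsuppAntidiag d := by
        rw [Finset.mem_finsuppAntidiag]
        refine ⟨?_, Finset.subset_univ _⟩
        rw [← Finsupp.degree_eq_sum, Finsupp.degree_single]
      rw [genericForm, map_sum, Finset.sum_eq_single (⟨_, hmem⟩ : Mono N d)]
      · simp [he, coeffs, X_pow_eq_monomial]
      · intro b _ hb
        have hb' : Finsupp.single i d ≠ (b : Fin (N + 1) →₀ ℕ) := fun h => hb (Subtype.ext h.symm)
        simp [he, coeffs, X_pow_eq_monomial, hb']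
      · simp
    have hM : M.map e = 1 := by
      ext μ ν
      have h3 : ((μ : Fin (N + 1) →₀ ℕ) - Finsupp.single (ι μ) d) + Finsupp.single (ι μ) d = μ :=
        tsub_add_cancel_of_le (by
          rw [Finsupp.single_le_iff]
          exact hι μ)
      have h4 : MvPolynomial.map (e : CoeffRing N d →+* ℤ) (P μ) = monomial (μ : _ →₀ ℕ) 1 := by
        simp only [P, map_mul, hF, map_monomial, map_one, X_pow_eq_monomial, monomial_mul, h3,
          mul_one]
      have h5 : e (M μ ν) =
          coeff (ν : Fin (N + 1) →₀ ℕ) (MvPolynomial.map (e : CoeffRing N d →+* ℤ) (P μ)) := by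
        rw [coeff_map]
        rfl
      rw [Matrix.map_apply, h5, h4, coeff_monomial, Matrix.one_apply]
      simp only [Subtype.ext_iff]
    rw [AlgHom.map_det, AlgHom.mapMatrix_apply, hM, Matrix.det_one]

theorem exists_universalResultant (N d : ℕ) : ∃ r, IsUniversalResultant N d r := by
  obtain ⟨g, hg⟩ := exists_gcd_of_set {f | IsEliminant N d f}
  obtain ⟨f, hf, hf1⟩ := exists_eliminant N d
  set e := aeval (R := ℤ)
    (coeffs d fun i : Fin (N + 1) => (X i ^ d : MvPolynomial (Fin (N + 1)) ℤ)) with he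
  have h1 : IsUnit (e g) := by
    have h2 : g ∣ f := (hg g).1 dvd_rfl f hf
    have h3 := map_dvd e h2
    rw [hf1] at h3
    exact isUnit_of_dvd_one h3
  rcases Int.isUnit_iff.1 h1 with h | h
  · exact ⟨g, hg, h⟩
  · exact ⟨-g, fun s => by rw [dvd_neg]; exact hg s, by rw [← he, map_neg, h, neg_neg]⟩

/-- The universal resultant `Res ∈ ℤ[u]`. -/
def universalResultant (N d : ℕ) : CoeffRing N d := (exists_universalResultant N d).choose

theorem universalResultant_spec (N d : ℕ) :
    IsUniversalResultant N d (universalResultant N d) :=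
  (exists_universalResultant N d).choose_spec

/-- The resultant `Res(Φ)` of `N + 1` forms of degree `d` in `N + 1` variables. -/
def resultant {S : Type*} [CommRing S] {N : ℕ} (d : ℕ)
    (Φ : Fin (N + 1) → MvPolynomial (Fin (N + 1)) S) : S :=
  aeval (coeffs d Φ) (universalResultant N d)

/-! ### Morphisms of projective space, their lifts and models -/

section Morphisms

variable {F : Type*} [Field F] {N : ℕ}

/-- The map `𝔸^{N+1}(F̄) → 𝔸^{N+1}(F̄)` defined by an `(N + 1)`-tuple of polynomials over `F`. -/
def evalMap (Φ : Fin (N + 1) → MvPolynomial (Fin (N + 1)) F)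
    (a : Fin (N + 1) → AlgebraicClosure F) : Fin (N + 1) → AlgebraicClosure F :=
  fun i => aeval a (Φ i)

/-- `Φ` consists of forms of the common degree `d`, and `Φ(a) ≠ 0` for all nonzero
`a ∈ 𝔸^{N+1}(F̄)`. -/
structure IsNonvanishing (d : ℕ) (Φ : Fin (N + 1) → MvPolynomial (Fin (N + 1)) F) : Prop where
  homogeneous : ∀ i, (Φ i).IsHomogeneous d
  ne_zero : ∀ a, a ≠ 0 → evalMap Φ a ≠ 0

/-- The geometric points `ℙ^N(F̄)`. -/
abbrev Points (F : Type*) [Field F] (N : ℕ) : Type _ :=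
  Projectivization (AlgebraicClosure F) (Fin (N + 1) → AlgebraicClosure F)

/-- `Φ` is a tuple of forms of degree `d` over `F`, without nontrivial common zero over `F̄`, and
`φ(x_0 : … : x_N) = (Φ_0(x) : … : Φ_N(x))`. -/
structure Represents (d : ℕ) (Φ : Fin (N + 1) → MvPolynomial (Fin (N + 1)) F)
    (φ : Points F N → Points F N) : Prop extends IsNonvanishing d Φ where
  apply_mk : ∀ (a : Fin (N + 1) → AlgebraicClosure F) (ha : a ≠ 0),
    φ (Projectivization.mk _ a ha) = Projectivization.mk _ (evalMap Φ a) (ne_zero a ha)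

/-- A morphism `ℙ^N → ℙ^N` of algebraic degree `d` defined over `F`. -/
structure ProjMorphism (F : Type*) [Field F] (N d : ℕ) where
  /-- the map on geometric points -/
  toFun : Points F N → Points F N
  exists_lift : ∃ Φ : Fin (N + 1) → MvPolynomial (Fin (N + 1)) F, Represents d Φ toFun

/-- `Φ` is a homogeneous lift, over `F`, of the morphism `φ`. -/
def IsLift {d : ℕ} (Φ : Fin (N + 1) → MvPolynomial (Fin (N + 1)) F) (φ : ProjMorphism F N d) :
    Prop :=
  Represents d Φ φ.toFun

/-- The conjugate `A ∘ Φ ∘ A⁻¹`. -/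
def conj (A : GL (Fin (N + 1)) F) (Φ : Fin (N + 1) → MvPolynomial (Fin (N + 1)) F) :
    Fin (N + 1) → MvPolynomial (Fin (N + 1)) F :=
  fun i => ∑ j, C ((A : Matrix _ _ F) i j) *
    bind₁ (fun k => ∑ l, C (((A⁻¹ : GL (Fin (N + 1)) F) : Matrix _ _ F) k l) * X l) (Φ j)

/-- `Ψ` is a model, over `F`, of the morphism `φ`. -/
def IsModel {d : ℕ} (Ψ : Fin (N + 1) → MvPolynomial (Fin (N + 1)) F) (φ : ProjMorphism F N d) :
    Prop :=
  ∃ (Φ : Fin (N + 1) → MvPolynomial (Fin (N + 1)) F) (A : GL (Fin (N + 1)) F),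
    IsLift Φ φ ∧ Ψ = conj A Φ

theorem evalMap_smul {d : ℕ} {Φ : Fin (N + 1) → MvPolynomial (Fin (N + 1)) F}
    (h : ∀ i, (Φ i).IsHomogeneous d) (c : AlgebraicClosure F)
    (a : Fin (N + 1) → AlgebraicClosure F) : evalMap Φ (c • a) = c ^ d • evalMap Φ a := by
  ext i
  simp only [evalMap, Pi.smul_apply, smul_eq_mul, aeval_def, eval₂_eq', Finset.mul_sum]
  refine Finset.sum_congr rfl fun m hm => ?_
  have h1 : m.degree = d := by
    by_contra h2
    exact (mem_support_iff.1 hm) ((h i).coeff_eq_zero h2)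
  have h3 : ∏ j, (c • a) j ^ m j = c ^ d * ∏ j, a j ^ m j := by
    simp only [Pi.smul_apply, smul_eq_mul, mul_pow, Finset.prod_mul_distrib,
      Finset.prod_pow_eq_pow_sum]
    rw [← h1, Finsupp.degree_eq_sum]
  simp only [Pi.smul_apply, smul_eq_mul] at h3
  rw [h3]
  ring

theorem represents_ofForms {d : ℕ} (Φ : Fin (N + 1) → MvPolynomial (Fin (N + 1)) F)
    (h : IsNonvanishing d Φ) : Represents d Φ fun x =>
      Projectivization.mk _ (evalMap Φ x.rep) (h.ne_zero _ x.rep_nonzero) := by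
  refine ⟨h, fun a ha => ?_⟩
  obtain ⟨c, hc⟩ := Projectivization.exists_smul_eq_mk_rep (AlgebraicClosure F) a ha
  rw [Projectivization.mk_eq_mk_iff']
  refine ⟨(c : AlgebraicClosure F) ^ d, ?_⟩
  rw [← evalMap_smul h.homogeneous]
  exact congrArg (evalMap Φ) hc

/-- The morphism defined by a tuple of forms without nontrivial common zero. -/
def ProjMorphism.ofForms {d : ℕ} (Φ : Fin (N + 1) → MvPolynomial (Fin (N + 1)) F)
    (h : IsNonvanishing d Φ) : ProjMorphism F N d where
  toFun x := Projectivization.mk _ (evalMap Φ x.rep) (h.ne_zero _ x.rep_nonzero)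
  exists_lift := ⟨Φ, represents_ofForms Φ h⟩

theorem ProjMorphism.ofForms_isLift {d : ℕ} (Φ : Fin (N + 1) → MvPolynomial (Fin (N + 1)) F)
    (h : IsNonvanishing d Φ) : IsLift Φ (ProjMorphism.ofForms Φ h) :=
  represents_ofForms Φ h

end Morphisms

/-! ### Extension of the base field -/

section BaseChange

variable {K : Type*} [Field K] (L : Type*) [Field L] [Algebra K L] {N d : ℕ}

/-- The tuple `Φ`, with its coefficients regarded as elements of `L`. -/
def mapForms (Φ : Fin (N + 1) → MvPolynomial (Fin (N + 1)) K) :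
    Fin (N + 1) → MvPolynomial (Fin (N + 1)) L :=
  fun i => MvPolynomial.map (algebraMap K L) (Φ i)

variable {L} in
theorem IsNonvanishing.mapForms {Φ : Fin (N + 1) → MvPolynomial (Fin (N + 1)) K}
    (h : IsNonvanishing d Φ) : IsNonvanishing d (mapForms L Φ) := by
  refine ⟨fun i => (h.homogeneous i).map _, fun a ha h0 => ha ?_⟩
  let σ : AlgebraicClosure K →ₐ[K] AlgebraicClosure L := IsAlgClosed.lift
  let I : Ideal (MvPolynomial (Fin (N + 1)) (AlgebraicClosure K)) :=
    Ideal.span (Set.range fun i => MvPolynomial.map (algebraMap K (AlgebraicClosure K)) (Φ i))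
  have hz : ∀ x ∈ zeroLocus (AlgebraicClosure K) I, x = 0 := by
    intro x hx
    by_contra hx0
    refine h.ne_zero x hx0 ?_
    ext i
    have := hx _ (Ideal.subset_span ⟨i, rfl⟩)
    rwa [aeval_map_algebraMap] at this
  ext i
  have hX : (X i : MvPolynomial (Fin (N + 1)) (AlgebraicClosure K)) ∈ I.radical := by
    rw [← vanishingIdeal_zeroLocus_eq_radical (K := AlgebraicClosure K)]
    intro x hx
    rw [hz x hx]
    simp
  obtain ⟨m, hm⟩ := hX
  have hle : I ≤ RingHom.ker (eval₂Hom (σ : AlgebraicClosure K →+* AlgebraicClosure L) a) := by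
    rw [Ideal.span_le]
    rintro _ ⟨j, rfl⟩
    have h1 := congrFun h0 j
    simp only [evalMap, GlobalMinimal.mapForms, aeval_map_algebraMap, Pi.zero_apply] at h1
    rw [SetLike.mem_coe, RingHom.mem_ker, coe_eval₂Hom, eval₂_map, σ.comp_algebraMap]
    rwa [aeval_def] at h1
  have h2 := hle hm
  rw [RingHom.mem_ker, map_pow] at h2
  simpa using eq_zero_of_pow_eq_zero h2

/-- The morphism `φ` over `K`, regarded as a morphism over the extension field `L`. -/
def ProjMorphism.baseChange (φ : ProjMorphism K N d) : ProjMorphism L N d :=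
  .ofForms (mapForms L φ.exists_lift.choose) φ.exists_lift.choose_spec.toIsNonvanishing.mapForms

variable {L} in
/-- The base change does not depend on the lift chosen in its definition: every lift of `φ` over
`K` is a lift over `L` of the base change. -/
theorem IsLift.baseChange {φ : ProjMorphism K N d}
    {Φ : Fin (N + 1) → MvPolynomial (Fin (N + 1)) K} (hΦ : IsLift Φ φ) :
    IsLift (mapForms L Φ) (φ.baseChange L) := by
  have h0 := φ.exists_lift.choose_spec
  have hL0 := h0.toIsNonvanishing.mapForms (L := L)
  have hL := hΦ.toIsNonvanishing.mapForms (L := L)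
  -- the two lifts have proportional values, first over the algebraic closure of `K`
  have hpoly : ∀ i j, φ.exists_lift.choose i * Φ j = φ.exists_lift.choose j * Φ i := by
    intro i j
    refine MvPolynomial.map_injective _ (algebraMap K (AlgebraicClosure K)).injective ?_
    refine MvPolynomial.funext fun a => ?_
    simp only [eval_map, ← aeval_def, map_mul]
    rcases eq_or_ne a 0 with rfl | ha
    · rcases Nat.eq_zero_or_pos d with hd | hd
      · have hc : ∀ (Θ : Fin (N + 1) → MvPolynomial (Fin (N + 1)) K),
            (∀ i, (Θ i).IsHomogeneous d) → ∀ i, ∀ x : Fin (N + 1) → AlgebraicClosure K,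
            aeval x (Θ i) = aeval (0 : Fin (N + 1) → AlgebraicClosure K) (Θ i) := by
          intro Θ hΘ i x
          have := congrFun (evalMap_smul hΘ 0 x) i
          simpa [evalMap, hd] using this.symm
        have h1 := (h0.apply_mk 1 one_ne_zero).symm.trans (hΦ.apply_mk 1 one_ne_zero)
        rw [Projectivization.mk_eq_mk_iff'] at h1
        obtain ⟨c, hc1⟩ := h1
        have h2 : ∀ i, c * aeval 1 (Φ i) = aeval 1 (φ.exists_lift.choose i) :=
          fun i => congrFun hc1 i
        rw [← hc _ h0.homogeneous i 1, ← hc _ h0.homogeneous j 1, ← hc _ hΦ.homogeneous i 1,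
          ← hc _ hΦ.homogeneous j 1, ← h2 i, ← h2 j]
        ring
      · have hz : ∀ i, aeval (0 : Fin (N + 1) → AlgebraicClosure K) (Φ i) = 0 := by
          intro i
          have := congrFun (evalMap_smul hΦ.homogeneous 0 0) i
          simpa [evalMap, hd.ne'] using this
        rw [hz i, hz j, mul_zero, mul_zero]
    · have h1 := (h0.apply_mk a ha).symm.trans (hΦ.apply_mk a ha)
      rw [Projectivization.mk_eq_mk_iff'] at h1
      obtain ⟨c, hc1⟩ := h1
      have h2 : ∀ i, c * aeval a (Φ i) = aeval a (φ.exists_lift.choose i) :=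
        fun i => congrFun hc1 i
      rw [← h2 i, ← h2 j]
      ring
  refine ⟨hL, fun b hb => ?_⟩
  obtain ⟨_, hofs⟩ := ProjMorphism.ofForms_isLift _ hL0
  refine (hofs b hb).trans ?_
  rw [Projectivization.mk_eq_mk_iff']
  obtain ⟨k, hk⟩ := Function.ne_iff.1 (hL.ne_zero b hb)
  refine ⟨evalMap (GlobalMinimal.mapForms L φ.exists_lift.choose) b k /
    evalMap (GlobalMinimal.mapForms L Φ) b k, ?_⟩
  ext i
  have h3 := congrArg (aeval b) (hpoly k i)
  simp only [map_mul] at h3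
  simp only [evalMap, GlobalMinimal.mapForms, aeval_map_algebraMap, Pi.smul_apply, smul_eq_mul,
    Pi.zero_apply] at hk ⊢
  field_simp
  linear_combination h3

end BaseChange

/-! ### Integral and minimal models -/

section Minimal

open IsDedekindDomain

variable {R : Type*} [CommRing R] [IsDedekindDomain R] {K : Type*} [Field K] [Algebra R K]
  [IsFractionRing R K] {N d : ℕ}

/-- `Ψ` is a `𝔭`-integral model of the morphism `φ`, which is defined over the completion `K_𝔭`. -/
def IsIntegralModel (p : HeightOneSpectrum R)
    (Ψ : Fin (N + 1) → MvPolynomial (Fin (N + 1)) (p.adicCompletion K))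
    (φ : ProjMorphism (p.adicCompletion K) N d) : Prop :=
  IsModel Ψ φ ∧ ∀ i m, coeff m (Ψ i) ∈ p.adicCompletionIntegers K

/-- `Ψ` is a `𝔭`-minimal model of the morphism `φ`, which is defined over the completion `K_𝔭`:
it is a `𝔭`-integral model, and `ord_𝔭 (Res Ψ) ≤ ord_𝔭 (Res Ψ')` for every `𝔭`-integral model
`Ψ'` of `φ`. The valuation `Valued.v` of `K_𝔭` is multiplicative, `Valued.v x = exp (- ord_𝔭 x)`,
so the inequality is reversed. -/
def IsMinimalModel (p : HeightOneSpectrum R)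
    (Ψ : Fin (N + 1) → MvPolynomial (Fin (N + 1)) (p.adicCompletion K))
    (φ : ProjMorphism (p.adicCompletion K) N d) : Prop :=
  IsIntegralModel p Ψ φ ∧
    ∀ Ψ', IsIntegralModel p Ψ' φ → Valued.v (resultant d Ψ') ≤ Valued.v (resultant d Ψ)

end Minimal

end GlobalMinimal

end

/-! Among the models with coefficients in `R`, choose `Ψ` for which the ideal generated by the
resultant is maximal; this is possible because `R` is noetherian. If a `𝔭`-integral model `Ψ'` had a
resultant of smaller order at `𝔭`, then `Ψ'` would be `c · A ∘ Ψ ∘ A⁻¹` with `A` and `c` over `K_𝔭`,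
since two lifts of a morphism are proportional (`IsModel.exists_eq_smul_act`). The pair `(A, c)` is
replaced by a global one. The vectors of `K^n` that `A` makes `𝔭`-integral and that are integral at
all other primes form a lattice, which is free because `R` is a PID. A basis of it gives `B` over
`K` with `B A⁻¹ ∈ GL(R_𝔭)` and `B ∈ GL(R_𝔮)` for `𝔮 ≠ 𝔭` (`exists_global_matrix`). A power of a
generator of `𝔭` gives a scalar `a` with the order of `c` at `𝔭` that is a unit elsewhere. Then `a ·
B ∘ Ψ ∘ B⁻¹` is integral everywhere, and its resultant has the order of `Res Ψ'` at `𝔭` and that of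
`Res Ψ` elsewhere (`exists_model_of_local_model`). Its ideal is strictly larger, a contradiction.
The resultant must keep its order under integral changes of coordinates with integral inverse. No
exact transformation formula is needed for this: `Res(P ∘ Φ ∘ Q)` divides `(det P · det Q)^n · Res
Φ` for some `n` (`exists_resultant_act_dvd`), and this is applied to the matrices and to their
inverses. The divisibility is proved for generic forms and generic matrices, from the description of
the resultant as the gcd of the elimination ideal. -/

noncomputable section

namespace GlobalMinimal

/-! ### Linear substitutions on both sides of a tuple of forms -/

section Action

variable {S : Type*} [CommRing S] {N : ℕ}

/-- The linear forms given by the rows of a matrix. -/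
def linForm (Q : Matrix (Fin (N + 1)) (Fin (N + 1)) S) (k : Fin (N + 1)) :
    MvPolynomial (Fin (N + 1)) S :=
  ∑ l, C (Q k l) * X l

/-- The tuple `P ∘ Φ ∘ Q`, for square matrices `P` and `Q`. -/
def act (P Q : Matrix (Fin (N + 1)) (Fin (N + 1)) S)
    (Φ : Fin (N + 1) → MvPolynomial (Fin (N + 1)) S) :
    Fin (N + 1) → MvPolynomial (Fin (N + 1)) S :=
  fun i => ∑ j, C (P i j) * bind₁ (linForm Q) (Φ j)

theorem isHomogeneous_linForm (Q : Matrix (Fin (N + 1)) (Fin (N + 1)) S) (k : Fin (N + 1)) :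
    (linForm Q k).IsHomogeneous 1 :=
  IsHomogeneous.sum _ _ _ fun _ _ => (isHomogeneous_X _ _).C_mul _

theorem bind₁_linForm_linForm (P Q : Matrix (Fin (N + 1)) (Fin (N + 1)) S) (k : Fin (N + 1)) :
    bind₁ (linForm Q) (linForm P k) = linForm (P * Q) k := by
  simp only [linForm, map_sum, map_mul, bind₁_C_right, bind₁_X_right, Matrix.mul_apply,
    Finset.mul_sum, Finset.sum_mul]
  rw [Finset.sum_comm]
  simp only [mul_assoc]

theorem bind₁_linForm_bind₁_linForm (P Q : Matrix (Fin (N + 1)) (Fin (N + 1)) S)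
    (p : MvPolynomial (Fin (N + 1)) S) :
    bind₁ (linForm Q) (bind₁ (linForm P) p) = bind₁ (linForm (P * Q)) p := by
  rw [bind₁_bind₁]
  simp only [bind₁_linForm_linForm]

theorem act_act (P Q P' Q' : Matrix (Fin (N + 1)) (Fin (N + 1)) S)
    (Φ : Fin (N + 1) → MvPolynomial (Fin (N + 1)) S) :
    act P Q (act P' Q' Φ) = act (P * P') (Q' * Q) Φ := by
  funext i
  simp only [act, map_sum, map_mul, bind₁_C_right, bind₁_linForm_bind₁_linForm,
    Matrix.mul_apply, Finset.mul_sum, Finset.sum_mul]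
  rw [Finset.sum_comm]
  simp only [mul_assoc]

theorem isHomogeneous_act {d : ℕ} (P Q : Matrix (Fin (N + 1)) (Fin (N + 1)) S)
    {Φ : Fin (N + 1) → MvPolynomial (Fin (N + 1)) S} (h : ∀ i, (Φ i).IsHomogeneous d)
    (i : Fin (N + 1)) : (act P Q Φ i).IsHomogeneous d := by
  refine IsHomogeneous.sum _ _ _ fun j _ => IsHomogeneous.C_mul ?_ _
  simpa using! (h j).aeval (linForm Q) (isHomogeneous_linForm Q)

theorem map_linForm {S' : Type*} [CommRing S'] (θ : S →+* S')
    (Q : Matrix (Fin (N + 1)) (Fin (N + 1)) S) (k : Fin (N + 1)) :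
    MvPolynomial.map θ (linForm Q k) = linForm (Q.map θ) k := by
  simp [linForm]

theorem map_act {S' : Type*} [CommRing S'] (θ : S →+* S')
    (P Q : Matrix (Fin (N + 1)) (Fin (N + 1)) S)
    (Φ : Fin (N + 1) → MvPolynomial (Fin (N + 1)) S) :
    (fun i => MvPolynomial.map θ (act P Q Φ i)) =
      act (P.map θ) (Q.map θ) fun i => MvPolynomial.map θ (Φ i) := by
  funext i
  simp only [act, map_sum, map_mul, map_C, map_bind₁, map_linForm, Matrix.map_apply]

theorem bind₁_linForm_smul_one {d : ℕ} (b : S) {p : MvPolynomial (Fin (N + 1)) S}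
    (hp : p.IsHomogeneous d) :
    bind₁ (linForm (b • (1 : Matrix (Fin (N + 1)) (Fin (N + 1)) S))) p = C (b ^ d) * p := by
  have hl : ∀ k, linForm (b • (1 : Matrix (Fin (N + 1)) (Fin (N + 1)) S)) k = C b * X k := by
    intro k
    rw [linForm, Finset.sum_eq_single k]
    · simp
    · intro l _ hl
      simp [Matrix.one_apply_ne hl.symm]
    · simp
  have h2 : bind₁ (linForm (b • (1 : Matrix (Fin (N + 1)) (Fin (N + 1)) S))) p =
      ∑ m ∈ p.support, C (b ^ d) * monomial m (coeff m p) := by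
    rw [bind₁, aeval_def, eval₂_eq']
    refine Finset.sum_congr rfl fun m hm => ?_
    have h1 : m.degree = d := by
      by_contra h2
      exact (mem_support_iff.1 hm) (hp.coeff_eq_zero h2)
    simp only [hl, mul_pow, Finset.prod_mul_distrib, Finset.prod_pow_eq_pow_sum, ← h1,
      Finsupp.degree_eq_sum, monomial_eq, Finsupp.prod_fintype, pow_zero, implies_true,
      algebraMap_eq, map_pow]
    ring
  rw [h2, ← Finset.mul_sum, support_sum_monomial_coeff]

theorem act_smul_one {d : ℕ} (a b : S) {Φ : Fin (N + 1) → MvPolynomial (Fin (N + 1)) S}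
    (h : ∀ i, (Φ i).IsHomogeneous d) :
    act (a • 1) (b • 1) Φ = fun i => C (a * b ^ d) * Φ i := by
  funext i
  simp only [act, bind₁_linForm_smul_one b (h _)]
  rw [Finset.sum_eq_single i]
  · simp [mul_assoc]
  · intro j _ hj
    simp [Matrix.one_apply_ne hj.symm]
  · simp

theorem act_one_one (Φ : Fin (N + 1) → MvPolynomial (Fin (N + 1)) S) : act 1 1 Φ = Φ := by
  have hl : linForm (1 : Matrix (Fin (N + 1)) (Fin (N + 1)) S) = X := by
    funext k
    rw [linForm, Finset.sum_eq_single k]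
    · simp
    · intro l _ hl
      simp [Matrix.one_apply_ne hl.symm]
    · simp
  funext i
  rw [act, hl, bind₁_X_left, Finset.sum_eq_single i]
  · simp
  · intro j _ hj
    simp [Matrix.one_apply_ne hj.symm]
  · simp

end Action

/-! ### Specialization of the generic forms -/

section Coefficients

variable {S : Type*} [CommRing S] {N d : ℕ}

/-- The evaluation of polynomials in the coefficients of the generic forms at a tuple. -/
def evalCoeffs (d : ℕ) (Φ : Fin (N + 1) → MvPolynomial (Fin (N + 1)) S) : CoeffRing N d →+* S :=
  (aeval (R := ℤ) (coeffs d Φ)).toRingHom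

theorem resultant_eq_evalCoeffs (Φ : Fin (N + 1) → MvPolynomial (Fin (N + 1)) S) :
    resultant d Φ = evalCoeffs d Φ (universalResultant N d) :=
  rfl

@[simp]
theorem evalCoeffs_X (Φ : Fin (N + 1) → MvPolynomial (Fin (N + 1)) S)
    (p : Fin (N + 1) × Mono N d) : evalCoeffs d Φ (X p) = coeffs d Φ p :=
  aeval_X _ _

theorem evalCoeffs_map {S' : Type*} [CommRing S'] (θ : S →+* S')
    (Φ : Fin (N + 1) → MvPolynomial (Fin (N + 1)) S) (f : CoeffRing N d) :
    evalCoeffs d (fun i => MvPolynomial.map θ (Φ i)) f = θ (evalCoeffs d Φ f) := by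
  have h : evalCoeffs d (fun i => MvPolynomial.map θ (Φ i)) = θ.comp (evalCoeffs d Φ) := by
    refine MvPolynomial.ringHom_ext (fun a => ?_) fun p => ?_
    · exact RingHom.congr_fun (RingHom.ext_int
        ((evalCoeffs d fun i => MvPolynomial.map θ (Φ i)).comp C)
        ((θ.comp (evalCoeffs d Φ)).comp C)) a
    · rw [RingHom.comp_apply, evalCoeffs_X, evalCoeffs_X]
      exact coeff_map θ _ _
  rw [h]
  rfl

theorem resultant_map {S' : Type*} [CommRing S'] (θ : S →+* S')
    (Φ : Fin (N + 1) → MvPolynomial (Fin (N + 1)) S) :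
    resultant d (fun i => MvPolynomial.map θ (Φ i)) = θ (resultant d Φ) :=
  evalCoeffs_map θ Φ _

theorem isHomogeneous_genericForm (i : Fin (N + 1)) : (genericForm N d i).IsHomogeneous d := by
  refine IsHomogeneous.sum _ _ _ fun α _ => isHomogeneous_monomial _ ?_
  rw [Finsupp.degree_eq_sum]
  exact (Finset.mem_finsuppAntidiag.1 α.2).1

theorem map_genericForm (θ : CoeffRing N d →+* S)
    {Φ : Fin (N + 1) → MvPolynomial (Fin (N + 1)) S} (h : ∀ i, (Φ i).IsHomogeneous d)
    (hθ : ∀ p, θ (X p) = coeffs d Φ p) (i : Fin (N + 1)) :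
    MvPolynomial.map θ (genericForm N d i) = Φ i := by
  refine MvPolynomial.ext _ _ fun γ => ?_
  simp only [genericForm, map_sum, map_monomial, coeff_sum, coeff_monomial, hθ, coeffs]
  by_cases hγ : γ ∈ (Finset.univ : Finset (Fin (N + 1))).finsuppAntidiag d
  · rw [Finset.sum_eq_single (⟨γ, hγ⟩ : Mono N d)]
    · simp
    · intro b _ hb
      rw [if_neg fun h => hb (Subtype.ext h)]
    · simp
  · rw [Finset.sum_eq_zero]
    · refine ((h i).coeff_eq_zero fun h => hγ ?_).symm
      rw [Finset.mem_finsuppAntidiag]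
      refine ⟨?_, Finset.subset_univ _⟩
      rw [← h, Finsupp.degree_eq_sum]
    · intro ν _
      rw [if_neg]
      rintro rfl
      exact hγ ν.2

theorem map_evalCoeffs_genericForm
    {Φ : Fin (N + 1) → MvPolynomial (Fin (N + 1)) S} (h : ∀ i, (Φ i).IsHomogeneous d)
    (i : Fin (N + 1)) : MvPolynomial.map (evalCoeffs d Φ) (genericForm N d i) = Φ i :=
  map_genericForm _ h (evalCoeffs_X Φ) i

theorem evalCoeffs_genericForm (f : CoeffRing N d) : evalCoeffs d (genericForm N d) f = f := by
  have h : evalCoeffs d (genericForm N d) = RingHom.id _ := by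
    refine MvPolynomial.ringHom_ext (fun a => ?_) fun p => ?_
    · exact RingHom.congr_fun (RingHom.ext_int
        ((evalCoeffs d (genericForm N d)).comp C) ((RingHom.id _).comp C)) a
    · simp only [evalCoeffs_X, coeffs, genericForm, coeff_sum, coeff_monomial]
      rw [Finset.sum_eq_single p.2]
      · simp
      · intro b _ hb
        rw [if_neg fun h => hb (Subtype.ext h)]
      · simp
  rw [h]
  rfl

theorem evalCoeffs_C_mul {e : ℕ} (c : S) (Φ : Fin (N + 1) → MvPolynomial (Fin (N + 1)) S)
    {f : CoeffRing N d} (hf : f.IsHomogeneous e) :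
    evalCoeffs d (fun i => C c * Φ i) f = c ^ e * evalCoeffs d Φ f := by
  change aeval (R := ℤ) _ f = _ * aeval (R := ℤ) _ f
  rw [aeval_def, aeval_def, eval₂_eq', eval₂_eq', Finset.mul_sum]
  refine Finset.sum_congr rfl fun m hm => ?_
  have h1 : m.degree = e := by
    by_contra h2
    exact (mem_support_iff.1 hm) (hf.coeff_eq_zero h2)
  simp only [coeffs, coeff_C_mul, mul_pow, Finset.prod_mul_distrib, Finset.prod_pow_eq_pow_sum]
  rw [← h1, Finsupp.degree_eq_sum]
  ring

end Coefficients

/-! ### Elimination ideals under base change and substitution -/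

section Elimination

variable {S : Type*} [CommRing S] {N : ℕ}

/-- `g` lies in the elimination ideal of the tuple `Φ`. -/
def Eliminates (Φ : Fin (N + 1) → MvPolynomial (Fin (N + 1)) S) (g : S) : Prop :=
  ∃ m : ℕ, ∀ i, C g * X i ^ m ∈ Ideal.span (Set.range Φ)

theorem Eliminates.map {S' : Type*} [CommRing S'] (θ : S →+* S')
    {Φ : Fin (N + 1) → MvPolynomial (Fin (N + 1)) S} {g : S} (h : Eliminates Φ g) :
    Eliminates (fun i => MvPolynomial.map θ (Φ i)) (θ g) := by
  obtain ⟨m, hm⟩ := h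
  refine ⟨m, fun i => ?_⟩
  have h1 := Ideal.mem_map_of_mem (MvPolynomial.map θ) (hm i)
  rw [Ideal.map_span, ← Set.range_comp] at h1
  simpa using! h1

theorem Eliminates.mono {Φ Φ' : Fin (N + 1) → MvPolynomial (Fin (N + 1)) S} {g : S}
    (h : Eliminates Φ g) (hΦ : ∀ i, Φ i ∈ Ideal.span (Set.range Φ')) : Eliminates Φ' g := by
  obtain ⟨m, hm⟩ := h
  refine ⟨m, fun i => ?_⟩
  refine (Ideal.span_le.2 ?_ : Ideal.span (Set.range Φ) ≤ _) (hm i)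
  rintro _ ⟨j, rfl⟩
  exact hΦ j

/-- After the substitution, powers of the linear forms `Q x`, rather than of the variables, are
multiplied by `g` into the ideal. Cramer's rule recovers `det Q · x_i` from these linear forms, at
the price of a power of `det Q`. -/
theorem Eliminates.bind₁ {Φ : Fin (N + 1) → MvPolynomial (Fin (N + 1)) S} {g : S}
    (h : Eliminates Φ g) (Q : Matrix (Fin (N + 1)) (Fin (N + 1)) S) :
    ∃ k, Eliminates (fun i => MvPolynomial.bind₁ (linForm Q) (Φ i)) (Q.det ^ k * g) := by
  obtain ⟨m, hm⟩ := h
  set I : Ideal (MvPolynomial (Fin (N + 1)) S) :=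
    Ideal.span (Set.range fun i => MvPolynomial.bind₁ (linForm Q) (Φ i)) with hI
  -- Passing to the radical of the colon ideal makes the condition linear, so that combinations of
  -- the `linForm Q i` can be taken.
  let J : Ideal (MvPolynomial (Fin (N + 1)) S) := I.colon {C g}
  have hJ : ∀ x, x ∈ J ↔ x * C g ∈ I := fun x => by
    simp only [J]
    rw [Submodule.mem_colon_singleton, smul_eq_mul]
  have h1 : ∀ i, linForm Q i ∈ J.radical := by
    intro i
    refine ⟨m, (hJ _).2 ?_⟩
    have h2 := Ideal.mem_map_of_mem
      (MvPolynomial.bind₁ (linForm Q) : _ →ₐ[S] MvPolynomial (Fin (N + 1)) S) (hm i)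
    rw [Ideal.map_span, ← Set.range_comp] at h2
    simpa [mul_comm] using! h2
  have h3 : ∀ i, C Q.det * X i ∈ J.radical := by
    intro i
    have h4 : (C Q.det * X i : MvPolynomial (Fin (N + 1)) S) =
        ∑ j, C (Q.adjugate i j) * linForm Q j := by
      simp only [linForm, Finset.mul_sum]
      rw [Finset.sum_comm]
      simp_rw [← mul_assoc, ← C_mul, ← Finset.sum_mul, ← map_sum, ← Matrix.mul_apply,
        Matrix.adjugate_mul]
      rw [Finset.sum_eq_single i]
      · simp
      · intro j _ hj
        simp [Matrix.one_apply_ne hj.symm]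
      · simp
    rw [h4]
    exact Ideal.sum_mem _ fun j _ => Ideal.mul_mem_left _ _ (h1 j)
  choose k hk using h3
  -- The sum bounds every `k i`, so it serves as a common exponent for `det Q` and for all the
  -- variables.
  refine ⟨∑ i, k i, ∑ i, k i, fun i => ?_⟩
  have h5 : (C Q.det * X i) ^ (∑ i, k i) * C g ∈ I := by
    rw [← hJ]
    exact J.pow_mem_of_pow_mem (hk i) (Finset.single_le_sum (fun _ _ => Nat.zero_le _)
      (Finset.mem_univ i))
  convert h5 using 1
  simp only [map_mul, map_pow, mul_pow]
  ring

/-- Once the two sets of variables are interchanged (by `τ`), the ideal is extended from constants,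
and membership in such an ideal is tested coefficientwise. -/
theorem Eliminates.coeff {σ : Type*} {Φ : Fin (N + 1) → MvPolynomial (Fin (N + 1)) S}
    {g : MvPolynomial σ S}
    (h : Eliminates (fun i => MvPolynomial.map (C : S →+* MvPolynomial σ S) (Φ i)) g)
    (μ : σ →₀ ℕ) : Eliminates Φ (coeff μ g) := by
  obtain ⟨m, hm⟩ := h
  refine ⟨m, fun i => ?_⟩
  let τ : MvPolynomial (Fin (N + 1)) (MvPolynomial σ S) →+*
      MvPolynomial σ (MvPolynomial (Fin (N + 1)) S) :=
    eval₂Hom (MvPolynomial.map C) fun i => C (X i)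
  have hτ : ∀ p : MvPolynomial (Fin (N + 1)) S, τ (MvPolynomial.map C p) = C p := by
    intro p
    have : τ.comp (MvPolynomial.map C) = C := by
      refine MvPolynomial.ringHom_ext (fun a => ?_) fun i => ?_ <;> simp [τ]
    exact RingHom.congr_fun this p
  have h1 := Ideal.mem_map_of_mem τ (hm i)
  rw [Ideal.map_span, ← Set.range_comp] at h1
  have h2 : Ideal.span (Set.range (τ ∘ fun i => MvPolynomial.map C (Φ i))) =
      Ideal.map C (Ideal.span (Set.range Φ)) := by
    rw [Ideal.map_span, ← Set.range_comp]
    congr 2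
    funext j
    exact hτ _
  rw [h2, MvPolynomial.mem_map_C_iff] at h1
  have h3 : τ (C g * X i ^ m) = MvPolynomial.map C g * C (X i ^ m) := by
    simp [τ]
  have h4 := h1 μ
  rw [h3, mul_comm, coeff_C_mul, coeff_map, mul_comm] at h4
  exact h4

end Elimination

/-! ### Homogeneity of the elimination ideal -/

section Homogeneous

variable {N d : ℕ}

theorem coeff_aeval_C_X_mul_X {σ A : Type*} [CommRing A] (f : MvPolynomial σ A) (e : ℕ) :
    coeff (Finsupp.single () e)
      (aeval (R := A) (fun p => (C (X p) * X () : MvPolynomial Unit (MvPolynomial σ A))) f) =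
      homogeneousComponent e f := by
  induction f using MvPolynomial.induction_on' with
  | monomial m a =>
    have h1 : aeval (R := A) (fun p => (C (X p) * X () : MvPolynomial Unit (MvPolynomial σ A)))
        (monomial m a) = C (monomial m a) * X () ^ m.degree := by
      rw [aeval_monomial, monomial_eq (s := m)]
      simp only [Finsupp.prod, mul_pow, Finset.prod_mul_distrib, Finset.prod_pow_eq_pow_sum,
        map_mul, map_prod, map_pow, Finsupp.degree]
      rw [mul_assoc]
      rfl
    rw [h1, coeff_C_mul, X_pow_eq_monomial, coeff_monomial]
    have h2 : (monomial m a : MvPolynomial σ A).IsHomogeneous m.degree :=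
      isHomogeneous_monomial _ rfl
    by_cases h : m.degree = e
    · subst h
      simp [homogeneousComponent_of_mem (h2 : _ ∈ homogeneousSubmodule σ A m.degree)]
    · rw [if_neg fun h' => h (Finsupp.single_injective () h'), mul_zero,
        homogeneousComponent_of_mem (h2 : _ ∈ homogeneousSubmodule σ A m.degree),
        if_neg fun h' => h h'.symm]
  | add p q hp hq => simp [hp, hq]

/-- The substitution `u ↦ t u` multiplies every generic form by `t`, so `f(t u)` still eliminates
the generic forms over `ℤ[u][t]`. Its coefficient at `t^e` is the component of degree `e`. -/
theorem IsEliminant.homogeneousComponent {f : CoeffRing N d} (hf : IsEliminant N d f) (e : ℕ) :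
    IsEliminant N d (homogeneousComponent e f) := by
  have h : Eliminates (genericForm N d) f := hf
  let θ : CoeffRing N d →+* MvPolynomial Unit (CoeffRing N d) :=
    (aeval (R := ℤ) fun p => C (X p) * X ()).toRingHom
  have h1 := h.map θ
  have h2 : Eliminates (fun i => MvPolynomial.map (C : _ →+* MvPolynomial Unit (CoeffRing N d))
      (genericForm N d i)) (θ f) := by
    refine h1.mono fun i => ?_
    have h3 : MvPolynomial.map θ (genericForm N d i) =
        C (X ()) * MvPolynomial.map C (genericForm N d i) := by
      simp only [genericForm, map_sum, map_monomial, Finset.mul_sum, C_mul_monomial]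
      refine Finset.sum_congr rfl fun α _ => ?_
      congr 1
      simp [θ, mul_comm]
    rw [h3]
    exact Ideal.mul_mem_left _ _ (Ideal.subset_span ⟨i, rfl⟩)
  have h4 := h2.coeff (Finsupp.single () e)
  rw [← coeff_aeval_C_X_mul_X]
  exact h4

end Homogeneous

/-! ### Divisibility of the transformed resultant, in the generic case -/

section UniversalDivisibility

variable {N d : ℕ}

/-- This passes from eliminants to their gcd `r`. Finitely many homogeneous eliminants generate the
elimination ideal, so one exponent works for all of them, and their gcd does not grow when the
variables `σ` are adjoined. -/
theorem IsUniversalResultant.dvd_C_of_dvd_mul {r : CoeffRing N d} (hr : IsUniversalResultant N d r)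
    {σ : Type*} [Finite σ] (Δ s : MvPolynomial σ (CoeffRing N d))
    (h : ∀ (f : CoeffRing N d) (e : ℕ), IsEliminant N d f → f.IsHomogeneous e →
      ∃ n, s ∣ Δ ^ n * C f) : ∃ n, s ∣ Δ ^ n * C r := by
  classical
  let T := MvPolynomial σ (CoeffRing N d)
  let _ : StrongNormalizationMonoid T := UniqueFactorizationMonoid.strongNormalizationMonoid
  let _ : NormalizedGCDMonoid T := UniqueFactorizationMonoid.toNormalizedGCDMonoid T
  let H : Set (CoeffRing N d) := {f | IsEliminant N d f ∧ ∃ e, f.IsHomogeneous e}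
  obtain ⟨t, htH, ht⟩ := (Submodule.fg_span_iff_fg_span_finset_subset H).1
    (IsNoetherian.noetherian (Ideal.span H))
  have hmem : ∀ f, IsEliminant N d f → f ∈ Ideal.span (t : Set (CoeffRing N d)) := by
    intro f hf
    have h1 : f ∈ Ideal.span H := by
      rw [← sum_homogeneousComponent f]
      exact Ideal.sum_mem _ fun e _ => Ideal.subset_span
        ⟨hf.homogeneousComponent e, e, homogeneousComponent_isHomogeneous e f⟩
    rwa [Ideal.span, ht] at h1
  have hdvd : ∀ g : CoeffRing N d, (∀ f ∈ t, g ∣ f) → g ∣ r := by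
    intro g hg
    rw [hr.dvd_iff]
    intro f hf
    have h1 : Ideal.span (t : Set (CoeffRing N d)) ≤ Ideal.span {g} := by
      rw [Ideal.span_le]
      exact fun f hf => Ideal.mem_span_singleton.2 (hg f hf)
    exact Ideal.mem_span_singleton.1 (h1 (hmem f hf))
  -- The eliminant with value `1` at `(x_0^d, …, x_N^d)` is nonzero, so the generators are not all
  -- zero.
  obtain ⟨f₀, hf₀, hf₀'⟩ : ∃ f ∈ t, f ≠ 0 := by
    by_contra! h0
    obtain ⟨f, hf, hf1⟩ := exists_eliminant N d
    have h1 := hmem f hf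
    have h2 : Ideal.span (t : Set (CoeffRing N d)) ≤ ⊥ := by
      rw [Ideal.span_le]
      intro g hg
      simpa using h0 g hg
    rw [Ideal.mem_bot.1 (h2 h1), map_zero] at hf1
    exact zero_ne_one hf1
  -- A divisor of the nonzero constant `C f₀` is itself a constant `C b`. Then `b` divides all
  -- generators, hence `r`.
  have hgcd : t.gcd (fun f => (C f : T)) ∣ C r := by
    have h1 : t.gcd (fun f => (C f : T)) ∣ C f₀ := Finset.gcd_dvd hf₀
    obtain ⟨b, -, hb⟩ := (dvd_C_iff_exists hf₀').1 h1
    rw [hb]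
    refine map_dvd C (hdvd b fun f hf => ?_)
    have h2 : t.gcd (fun f => (C f : T)) ∣ C f := Finset.gcd_dvd hf
    rw [hb, C_dvd_iff_dvd_coeff] at h2
    simpa using h2 0
  -- The value `0` off `t` only makes the exponent a total function.
  have hn : ∀ f : CoeffRing N d, ∃ n, f ∈ t → s ∣ Δ ^ n * C f := by
    intro f
    by_cases hf : f ∈ t
    · obtain ⟨h1, e, h2⟩ := htH hf
      obtain ⟨n, hn⟩ := h f e h1 h2
      exact ⟨n, fun _ => hn⟩
    · exact ⟨0, fun h => absurd h hf⟩
  choose n hn using hn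
  refine ⟨∑ f ∈ t, n f, ?_⟩
  have h3 : s ∣ t.gcd fun f => Δ ^ (∑ f ∈ t, n f) * (C f : T) := by
    refine Finset.dvd_gcd fun f hf => (hn f hf).trans (mul_dvd_mul_right (pow_dvd_pow _ ?_) _)
    exact Finset.single_le_sum (f := n) (fun _ _ => Nat.zero_le _) hf
  exact h3.trans ((Finset.gcd_mul_left' t _ _).dvd.trans (mul_dvd_mul_left _ hgcd))

variable (N) in
/-- The indices of the entries of two square matrices. -/
abbrev MatPair : Type := (Fin (N + 1) × Fin (N + 1)) ⊕ (Fin (N + 1) × Fin (N + 1))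

variable (N d) in
/-- The polynomial ring in the coefficients of the generic forms and the entries of two generic
matrices. -/
abbrev ActRing : Type := MvPolynomial (MatPair N) (CoeffRing N d)

variable (N d) in
/-- The first generic matrix. -/
def genericLeft : Matrix (Fin (N + 1)) (Fin (N + 1)) (ActRing N d) :=
  Matrix.of fun i j => X (Sum.inl (i, j))

variable (N d) in
/-- The second generic matrix. -/
def genericRight : Matrix (Fin (N + 1)) (Fin (N + 1)) (ActRing N d) :=
  Matrix.of fun i j => X (Sum.inr (i, j))

variable (N d) in
/-- The generic forms over the extended ring. -/
def genericTuple (i : Fin (N + 1)) : MvPolynomial (Fin (N + 1)) (ActRing N d) :=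
  MvPolynomial.map C (genericForm N d i)

theorem isHomogeneous_genericTuple (i : Fin (N + 1)) : (genericTuple N d i).IsHomogeneous d :=
  (isHomogeneous_genericForm i).map _

/-- The value of `f` at `adj P ∘ F ∘ adj Q` eliminates that tuple, hence also `F ∘ adj Q`, whose
components generate a larger ideal. Substituting `Q` turns `F ∘ adj Q` into a multiple of `F` and
costs a power of `det Q`. All coefficients of the result in the matrix entries are then eliminants,
which `r` divides. -/
theorem dvd_evalCoeffs_adjugate {r : CoeffRing N d} (hr : IsUniversalResultant N d r)
    {f : CoeffRing N d} (hf : IsEliminant N d f) :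
    ∃ k, C r ∣ (genericRight N d).det ^ k * evalCoeffs d
      (act (genericLeft N d).adjugate (genericRight N d).adjugate (genericTuple N d)) f := by
  set P := genericLeft N d
  set Q := genericRight N d
  set G := act P.adjugate Q.adjugate (genericTuple N d) with hG
  have hGh : ∀ i, (G i).IsHomogeneous d := isHomogeneous_act _ _ isHomogeneous_genericTuple
  have h : Eliminates (genericForm N d) f := hf
  have h1 := h.map (evalCoeffs d G)
  rw [show (fun i => MvPolynomial.map (evalCoeffs d G) (genericForm N d i)) = G from
    funext (map_evalCoeffs_genericForm hGh)] at h1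
  have h2 : Eliminates (fun j => bind₁ (linForm Q.adjugate) (genericTuple N d j))
      (evalCoeffs d G f) :=
    h1.mono fun i => Ideal.sum_mem _ fun j _ => Ideal.mul_mem_left _ _ (Ideal.subset_span ⟨j, rfl⟩)
  obtain ⟨k, hk⟩ := h2.bind₁ Q
  refine ⟨k, ?_⟩
  have h3 : Eliminates (genericTuple N d) (Q.det ^ k * evalCoeffs d G f) := by
    refine hk.mono fun i => ?_
    rw [bind₁_linForm_bind₁_linForm, Matrix.adjugate_mul,
      bind₁_linForm_smul_one _ (isHomogeneous_genericTuple i)]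
    exact Ideal.mul_mem_left _ _ (Ideal.subset_span ⟨i, rfl⟩)
  rw [C_dvd_iff_dvd_coeff]
  exact fun μ => (hr.dvd_iff r).1 dvd_rfl _ (h3.coeff μ)

/-- Replacing `F` by `P ∘ F ∘ Q` in the preceding divisibility makes the adjugates cancel up to
determinants. On the right, `f` is evaluated at a scalar multiple of `F`, and homogeneity extracts
the scalar. -/
theorem evalCoeffs_act_dvd {r : CoeffRing N d} (hr : IsUniversalResultant N d r)
    {f : CoeffRing N d} (hf : IsEliminant N d f) {e : ℕ} (hfe : f.IsHomogeneous e) :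
    ∃ n, evalCoeffs d (act (genericLeft N d) (genericRight N d) (genericTuple N d)) r ∣
      ((genericLeft N d).det * (genericRight N d).det) ^ n * C f := by
  obtain ⟨k, hk⟩ := dvd_evalCoeffs_adjugate hr hf
  set P := genericLeft N d with hP
  set Q := genericRight N d with hQ
  set G := act P Q (genericTuple N d) with hG
  have hGh : ∀ i, (G i).IsHomogeneous d := isHomogeneous_act _ _ isHomogeneous_genericTuple
  -- This replaces the generic coefficients by those of `P ∘ F ∘ Q` and fixes the entries of `P` and
  -- `Q`.
  let σ : ActRing N d →+* ActRing N d :=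
    eval₂Hom (evalCoeffs d G) X
  have hσC : ∀ g, σ (C g) = evalCoeffs d G g := fun g => by simp [σ]
  have hσP : P.map σ = P := by
    ext i j : 2
    simp [σ, hP, genericLeft]
  have hσQ : Q.map σ = Q := by
    ext i j : 2
    simp [σ, hQ, genericRight]
  have hdet : σ Q.det = Q.det := by
    rw [RingHom.map_det, RingHom.mapMatrix_apply, hσQ]
  have hadj : ∀ M : Matrix (Fin (N + 1)) (Fin (N + 1)) (ActRing N d), M.map σ = M →
      M.adjugate.map σ = M.adjugate := by
    intro M hM
    have := RingHom.map_adjugate σ M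
    rwa [RingHom.mapMatrix_apply, RingHom.mapMatrix_apply, hM] at this
  have hσF : (fun i => MvPolynomial.map σ (genericTuple N d i)) = G := by
    funext i
    rw [genericTuple, MvPolynomial.map_map]
    exact map_genericForm _ hGh (fun p => by simp [hσC]) i
  have h1 := map_dvd σ hk
  rw [hσC, map_mul, map_pow, hdet, ← evalCoeffs_map, map_act, hadj P hσP, hadj Q hσQ, hσF, hG,
    act_act, Matrix.adjugate_mul, Matrix.mul_adjugate, act_smul_one _ _ isHomogeneous_genericTuple,
    evalCoeffs_C_mul _ _ hfe] at h1
  have h2 : evalCoeffs d (genericTuple N d) f = C f :=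
    (evalCoeffs_map C _ f).trans (by rw [evalCoeffs_genericForm])
  rw [h2] at h1
  -- The factor obtained is `det Q^k · (det P · det Q^d)^e`; the cofactor completes it to a power of
  -- `det P · det Q`.
  refine ⟨k + (d + 1) * e, h1.trans ⟨P.det ^ (k + d * e) * Q.det ^ e, ?_⟩⟩
  ring

variable (N d) in
theorem exists_resultant_act_dvd_generic :
    ∃ n, resultant d (act (genericLeft N d) (genericRight N d) (genericTuple N d)) ∣
      ((genericLeft N d).det * (genericRight N d).det) ^ n * C (universalResultant N d) :=
  (universalResultant_spec N d).dvd_C_of_dvd_mul _ _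
    fun _ _ hf hfe => evalCoeffs_act_dvd (universalResultant_spec N d) hf hfe

theorem exists_resultant_act_dvd {S : Type*} [CommRing S]
    (P Q : Matrix (Fin (N + 1)) (Fin (N + 1)) S)
    {Φ : Fin (N + 1) → MvPolynomial (Fin (N + 1)) S} (h : ∀ i, (Φ i).IsHomogeneous d) :
    ∃ n, resultant d (act P Q Φ) ∣ (P.det * Q.det) ^ n * resultant d Φ := by
  obtain ⟨n, hn⟩ := exists_resultant_act_dvd_generic N d
  let θ : ActRing N d →+* S :=
    eval₂Hom (evalCoeffs d Φ)
      (Sum.elim (fun q => P q.1 q.2) fun q => Q q.1 q.2)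
  have hP : (genericLeft N d).map θ = P := by
    ext i j : 2
    simp [θ, genericLeft]
  have hQ : (genericRight N d).map θ = Q := by
    ext i j : 2
    simp [θ, genericRight]
  have hF : (fun i => MvPolynomial.map θ (genericTuple N d i)) = Φ := by
    funext i
    rw [genericTuple, MvPolynomial.map_map]
    exact map_genericForm _ h (fun p => by simp [θ]) i
  have h1 := map_dvd θ hn
  rw [← resultant_map, map_act, hP, hQ, hF, map_mul, map_pow, map_mul, RingHom.map_det,
    RingHom.map_det, RingHom.mapMatrix_apply, RingHom.mapMatrix_apply, hP, hQ] at h1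
  refine ⟨n, ?_⟩
  have h2 : θ (C (universalResultant N d)) = resultant d Φ := by
    simp [θ, resultant_eq_evalCoeffs]
  rwa [h2] at h1

end UniversalDivisibility

/-! ### Approximation and lattices: from one completion to the global field -/

section Gluing

open IsDedekindDomain

variable {R : Type*} [CommRing R] [IsDomain R] [IsPrincipalIdealRing R]
  {K : Type*} [Field K] [Algebra R K] [IsFractionRing R K]

theorem valued_algebraMap (p : HeightOneSpectrum R) (x : K) :
    Valued.v (algebraMap K (p.adicCompletion K) x) = p.valuation K x :=
  p.valuedAdicCompletion_eq_valuation' x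

theorem algebraMap_mem_adicCompletionIntegers_iff (p : HeightOneSpectrum R) (x : K) :
    algebraMap K (p.adicCompletion K) x ∈ p.adicCompletionIntegers K ↔ p.valuation K x ≤ 1 := by
  rw [HeightOneSpectrum.mem_adicCompletionIntegers, valued_algebraMap]

/-- A generator of the principal ideal `𝔭` works: it lies in no other nonzero prime, since `𝔭` is
maximal. -/
theorem exists_eq_exp_neg_one (p : HeightOneSpectrum R) :
    ∃ a : K, p.valuation K a = WithZero.exp (-1 : ℤ) ∧ ∀ q ≠ p, q.valuation K a = 1 := by
  obtain ⟨r, hr⟩ := IsPrincipalIdealRing.principal p.asIdeal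
  have hr0 : r ≠ 0 := by
    rintro rfl
    exact p.ne_bot (by simpa using hr)
  refine ⟨algebraMap R K r, ?_, fun q hq => ?_⟩
  · rw [HeightOneSpectrum.valuation_of_algebraMap]
    exact p.intValuation_singleton hr0 hr
  · rw [HeightOneSpectrum.valuation_eq_one_iff_notMem]
    intro h
    refine hq (HeightOneSpectrum.ext ?_)
    refine (p.isMaximal.eq_of_le q.isPrime.ne_top ?_).symm
    rw [hr]
    exact (Ideal.span_singleton_le_iff_mem _).2 h

theorem exists_mul_mem_integers (p : HeightOneSpectrum R) {ι : Type*} [Finite ι]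
    (z : ι → p.adicCompletion K) :
    ∃ a : K, a ≠ 0 ∧ p.valuation K a ≤ 1 ∧
      (∀ i, algebraMap K (p.adicCompletion K) a * z i ∈ p.adicCompletionIntegers K) ∧
      ∀ q ≠ p, q.valuation K a = 1 := by
  classical
  cases nonempty_fintype ι
  obtain ⟨π, hπ, hπ'⟩ := exists_eq_exp_neg_one (K := K) p
  have hπ0 : π ≠ 0 := by
    rintro rfl
    rw [map_zero] at hπ
    exact WithZero.coe_ne_zero hπ.symm
  -- `log` of the valuation is minus the order, so its positive part is the order of the pole of `z
  -- i`.
  have h1 : ∀ i, ∃ k : ℕ, WithZero.exp (-(k : ℤ)) * Valued.v (z i) ≤ 1 := by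
    intro i
    rcases eq_or_ne (Valued.v (z i)) 0 with h | h
    · exact ⟨0, by simp [h]⟩
    · refine ⟨(WithZero.log (Valued.v (z i))).toNat, ?_⟩
      rw [← WithZero.exp_log h, ← WithZero.exp_add, ← WithZero.exp_zero, WithZero.exp_le_exp,
        WithZero.log_exp]
      omega
  choose k hk using h1
  have hle : ∀ n : ℕ, p.valuation K (π ^ n) ≤ 1 := by
    intro n
    rw [map_pow, hπ]
    refine pow_le_one' ?_ _
    rw [← WithZero.exp_zero, WithZero.exp_le_exp]
    omega
  refine ⟨π ^ ∑ i, k i, pow_ne_zero _ hπ0, hle _, fun i => ?_, fun q hq => ?_⟩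
  · rw [HeightOneSpectrum.mem_adicCompletionIntegers, map_mul, valued_algebraMap,
      ← Finset.add_sum_erase _ _ (Finset.mem_univ i), pow_add, map_mul]
    have h2 : p.valuation K (π ^ k i) = WithZero.exp (-(k i : ℤ)) := by
      rw [map_pow, hπ, ← WithZero.exp_nsmul]
      simp
    calc _ = p.valuation K (π ^ ∑ j ∈ Finset.univ.erase i, k j) *
          (p.valuation K (π ^ k i) * Valued.v (z i)) := by
          rw [mul_comm (p.valuation K (π ^ k i)), mul_assoc]
      _ ≤ 1 := mul_le_one' (hle _) (by rw [h2]; exact hk i)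
  · rw [map_pow, hπ' q hq, one_pow]

theorem exists_valued_sub_le_of_denseRange {L Γ₀ ι : Type*} [Field L]
    [LinearOrderedCommGroupWithZero Γ₀] [Valued L Γ₀] {f : ι → L} (hf : DenseRange f) (w : L)
    {c : L} (hc : c ≠ 0) : ∃ y, Valued.v (f y - w) ≤ (Valued.v c : Γ₀) := by
  have hcont : Continuous fun y : L => (y - w) * c⁻¹ :=
    (continuous_id.sub continuous_const).mul continuous_const
  obtain ⟨y, hy⟩ := hf.exists_mem_open ((Valued.isOpen_integer L).preimage hcont)
    ⟨w, by rw [Set.mem_preimage, sub_self, zero_mul]; exact zero_mem _⟩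
  have h1 : Valued.v ((f y - w) * c⁻¹) ≤ (1 : Γ₀) := hy
  have h2 : (Valued.v c : Γ₀) ≠ 0 := (Valuation.ne_zero_iff _).2 hc
  rw [map_mul, map_inv₀, mul_inv_le_iff₀ (zero_lt_iff.2 h2), one_mul] at h1
  exact ⟨y, h1⟩

/-- With `a` clearing the denominator of `z` and a unit away from `𝔭`, the integral element `a z` is
approximated by some `r ∈ R` to precision `a c`. Then `r / a` has the required precision, and its
denominator involves only `𝔭`. -/
theorem exists_valued_sub_le (p : HeightOneSpectrum R) (z : p.adicCompletion K) {c : K}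
    (hc : c ≠ 0) (hc1 : p.valuation K c ≤ 1) :
    ∃ x : K, Valued.v (algebraMap K (p.adicCompletion K) x - z) ≤ p.valuation K c ∧
      ∀ q ≠ p, q.valuation K x ≤ 1 := by
  obtain ⟨a, ha0, ha1, haz, haq⟩ := exists_mul_mem_integers p fun _ : Unit => z
  set i := algebraMap K (p.adicCompletion K) with hi
  have hac0 : i (a * c) ≠ 0 := by simp [ha0, hc]
  obtain ⟨y, hy⟩ := exists_valued_sub_le_of_denseRange (p.denseRange_algebraMap K) (i a * z) hac0
  have hy1 : Valued.v (i y - i a * z) ≤ p.valuation K (a * c) := by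
    rwa [← valued_algebraMap]
  have hac1 : p.valuation K (a * c) ≤ 1 := by
    rw [map_mul]
    exact mul_le_one' ha1 hc1
  have hyint : p.valuation K y ≤ 1 := by
    rw [← algebraMap_mem_adicCompletionIntegers_iff]
    have h1 : i y = (i y - i a * z) + i a * z := by ring
    rw [← hi, h1]
    exact add_mem (hy1.trans hac1) (haz ())
  have hγ : p.valuation K (a * c) ≠ 0 := by
    rw [Valuation.ne_zero_iff]
    exact mul_ne_zero ha0 hc
  obtain ⟨r, hr⟩ := p.exists_valuation_sub_lt_of_integer hyint (Units.mk0 _ hγ)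
  refine ⟨algebraMap R K r / a, ?_, fun q hq => ?_⟩
  · have h1 : Valued.v (i (algebraMap R K r) - i a * z) ≤ p.valuation K (a * c) := by
      have h2 : i (algebraMap R K r) - i a * z =
          i (algebraMap R K r - y) + (i y - i a * z) := by
        rw [map_sub]
        ring
      rw [h2]
      refine (Valuation.map_add _ _ _).trans (max_le ?_ hy1)
      rw [valued_algebraMap]
      exact hr.le
    have ha' : i a ≠ 0 := by simp [ha0]
    have h3 : i (algebraMap R K r / a) - z = (i (algebraMap R K r) - i a * z) * (i a)⁻¹ := by
      rw [map_div₀]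
      field_simp
    rw [h3, map_mul, map_inv₀, valued_algebraMap]
    have hva : p.valuation K a ≠ 0 := (Valuation.ne_zero_iff _).2 ha0
    rw [mul_inv_le_iff₀ (zero_lt_iff.2 hva), mul_comm (p.valuation K c), ← map_mul]
    exact h1
  · rw [map_div₀, haq q hq, div_one]
    exact q.valuation_le_one r

variable {n : Type*} [Fintype n] [DecidableEq n]

/-- The lattice of the vectors in `K^n` which the matrix `A` over `K_𝔭` maps to integral vectors,
and which are integral at all primes other than `𝔭`. -/
def gluedLattice (p : HeightOneSpectrum R) (A : Matrix n n (p.adicCompletion K)) :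
    Submodule R (n → K) where
  carrier := {x | (∀ i, A.mulVec (fun j => algebraMap K (p.adicCompletion K) (x j)) i ∈
      p.adicCompletionIntegers K) ∧ ∀ q ≠ p, ∀ i, q.valuation K (x i) ≤ 1}
  zero_mem' := by
    refine ⟨fun i => ?_, fun q _ i => by simp⟩
    have : (fun j => algebraMap K (p.adicCompletion K) ((0 : n → K) j)) = 0 := by
      ext; simp
    rw [this, Matrix.mulVec_zero]
    exact zero_mem _
  add_mem' := by
    rintro x y ⟨hx, hx'⟩ ⟨hy, hy'⟩
    refine ⟨fun i => ?_, fun q hq i => ?_⟩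
    · have : (fun j => algebraMap K (p.adicCompletion K) ((x + y) j)) =
          (fun j => algebraMap K (p.adicCompletion K) (x j)) +
          fun j => algebraMap K (p.adicCompletion K) (y j) := by
        funext j
        simp
      rw [this, Matrix.mulVec_add]
      exact add_mem (hx i) (hy i)
    · exact (Valuation.map_add _ _ _).trans (max_le (hx' q hq i) (hy' q hq i))
  smul_mem' := by
    rintro r x ⟨hx, hx'⟩
    refine ⟨fun i => ?_, fun q hq i => ?_⟩
    · have : (fun j => algebraMap K (p.adicCompletion K) ((r • x) j)) =
          algebraMap K (p.adicCompletion K) (algebraMap R K r) •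
          fun j => algebraMap K (p.adicCompletion K) (x j) := by
        funext j
        simp [Algebra.smul_def]
      rw [this, Matrix.mulVec_smul]
      exact mul_mem ((algebraMap_mem_adicCompletionIntegers_iff p _).2 (p.valuation_le_one r))
        (hx i)
    · rw [Pi.smul_apply, Algebra.smul_def, map_mul]
      exact mul_le_one' (q.valuation_le_one r) (hx' q hq i)

theorem single_mem_gluedLattice {p : HeightOneSpectrum R} {A : Matrix n n (p.adicCompletion K)}
    {a : K} (ha : ∀ i j, algebraMap K (p.adicCompletion K) a * A i j ∈ p.adicCompletionIntegers K)
    (haq : ∀ q ≠ p, q.valuation K a = 1) (j : n) : Pi.single j a ∈ gluedLattice p A := by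
  refine ⟨fun i => ?_, fun q hq i => ?_⟩
  · have : (fun k => algebraMap K (p.adicCompletion K) ((Pi.single j a : n → K) k)) =
        Pi.single j (algebraMap K (p.adicCompletion K) a) := by
      funext k
      rcases eq_or_ne k j with rfl | h
      · simp
      · simp [h]
    rw [this, Matrix.mulVec_single]
    simpa [mul_comm] using ha i j
  · rcases eq_or_ne i j with rfl | h
    · simp [haq q hq]
    · simp [h]

theorem mul_mem_range_of_mem_gluedLattice {p : HeightOneSpectrum R}
    {A : GL n (p.adicCompletion K)} {a : K}
    (ha : ∀ i j, algebraMap K (p.adicCompletion K) a *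
      (↑A⁻¹ : Matrix n n (p.adicCompletion K)) i j ∈ p.adicCompletionIntegers K)
    (haq : ∀ q ≠ p, q.valuation K a = 1) {x : n → K}
    (hx : x ∈ gluedLattice p (A : Matrix n n (p.adicCompletion K))) (i : n) :
    a * x i ∈ (algebraMap R K).range := by
  refine HeightOneSpectrum.mem_integers_of_valuation_le_one K _ fun q => ?_
  rcases eq_or_ne q p with rfl | hq
  · rw [← algebraMap_mem_adicCompletionIntegers_iff]
    set y := (A : Matrix n n (q.adicCompletion K)).mulVec
      (fun j => algebraMap K (q.adicCompletion K) (x j)) with hy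
    have h1 : algebraMap K (q.adicCompletion K) (x i) =
        (↑A⁻¹ : Matrix n n (q.adicCompletion K)).mulVec y i := by
      rw [hy, Matrix.mulVec_mulVec, ← Units.val_mul, inv_mul_cancel, Units.val_one,
        Matrix.one_mulVec]
    rw [map_mul, h1, Matrix.mulVec, dotProduct, Finset.mul_sum]
    refine sum_mem fun j _ => ?_
    rw [← mul_assoc]
    exact mul_mem (ha i j) (hx.1 j)
  · rw [map_mul, haq q hq, one_mul]
    exact hx.2 q hq i

/-- Clearing the denominators of `A⁻¹` puts the module inside some `a⁻¹ R^n`, so it is finitely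
generated. Clearing those of `A` puts a multiple of each standard basis vector into it, so it spans.
-/
theorem isLattice_gluedLattice (p : HeightOneSpectrum R) (A : GL n (p.adicCompletion K)) :
    (gluedLattice p (A : Matrix n n (p.adicCompletion K))).IsLattice K := by
  constructor
  · obtain ⟨a, ha0, -, ha, haq⟩ := exists_mul_mem_integers p fun q : n × n =>
      (↑A⁻¹ : Matrix n n (p.adicCompletion K)) q.1 q.2
    have hle : gluedLattice p (A : Matrix n n (p.adicCompletion K)) ≤
        Submodule.span R (Set.range fun i : n => (Pi.single i a⁻¹ : n → K)) := by
      intro x hx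
      choose r hr using mul_mem_range_of_mem_gluedLattice (fun i j => ha (i, j)) haq hx
      have h1 : x = ∑ i, r i • (Pi.single i a⁻¹ : n → K) := by
        funext j
        rw [Finset.sum_apply, Finset.sum_eq_single j]
        · rw [Pi.smul_apply, Pi.single_eq_same, Algebra.smul_def, hr]
          field_simp
        · intro i _ hi
          simp [hi.symm]
        · simp
      rw [h1]
      exact Submodule.sum_mem _ fun i _ => Submodule.smul_mem _ _ (Submodule.subset_span ⟨i, rfl⟩)
    have hfg : (Submodule.span R (Set.range fun i : n => (Pi.single i a⁻¹ : n → K))).FG :=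
      Submodule.fg_span (Set.finite_range _)
    have := isNoetherian_of_fg_of_noetherian _ hfg
    have := isNoetherian_of_le hle
    rw [← Module.Finite.iff_fg]
    infer_instance
  · obtain ⟨a, ha0, -, ha, haq⟩ := exists_mul_mem_integers p fun q : n × n =>
      (A : Matrix n n (p.adicCompletion K)) q.1 q.2
    rw [eq_top_iff, ← (Pi.basisFun K n).span_eq, Submodule.span_le]
    rintro _ ⟨i, rfl⟩
    have h1 : Pi.basisFun K n i = a⁻¹ • (Pi.single i a : n → K) := by
      rw [Pi.basisFun_apply, ← Pi.single_smul, smul_eq_mul, inv_mul_cancel₀ ha0]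
    rw [h1]
    exact Submodule.smul_mem _ _ (Submodule.subset_span
      (single_mem_gluedLattice (fun i j => ha (i, j)) haq i))

/-- The matrices over `K_𝔭` which are integral and have an integral inverse. -/
def IsIntegralGL (p : HeightOneSpectrum R) (A : GL n (p.adicCompletion K)) : Prop :=
  ∀ i j, (A : Matrix n n (p.adicCompletion K)) i j ∈ p.adicCompletionIntegers K ∧
    (↑A⁻¹ : Matrix n n (p.adicCompletion K)) i j ∈ p.adicCompletionIntegers K

/-- Every matrix over `K_𝔭` is congruent, modulo matrices over the ring of integers, to a matrix
over `K` which is integral at the other primes. -/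
theorem exists_global_matrix (p : HeightOneSpectrum R) (A : GL n (p.adicCompletion K)) :
    ∃ B : GL n K,
      IsIntegralGL p (Matrix.GeneralLinearGroup.map (algebraMap K (p.adicCompletion K)) B * A⁻¹) ∧
      ∀ q ≠ p,
        IsIntegralGL q (Matrix.GeneralLinearGroup.map (algebraMap K (q.adicCompletion K)) B) := by
  set L := gluedLattice p (A : Matrix n n (p.adicCompletion K)) with hL
  have hlat : L.IsLattice K := isLattice_gluedLattice p A
  have htf : Module.IsTorsionFree R K := inferInstance
  have hcard : Module.finrank R L = Fintype.card n := Submodule.IsLattice.finrank_of_pi K L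
  let b : Module.Basis n R L :=
    (Module.finBasisOfFinrankEq R L hcard).reindex (Fintype.equivFin n).symm
  let b' : Module.Basis n K (n → K) := b.extendOfIsLattice K
  have hb' : ∀ j, b' j = (b j : n → K) := fun j => Module.Basis.extendOfIsLattice_apply K b j
  -- The columns of `B⁻¹` are the basis vectors of the lattice, so `B` takes a lattice vector to its
  -- coordinates in `R^n`.
  let B : GL n K := ⟨b'.toMatrix (Pi.basisFun K n), (Pi.basisFun K n).toMatrix b',
    Module.Basis.toMatrix_mul_toMatrix_flip _ _, Module.Basis.toMatrix_mul_toMatrix_flip _ _⟩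
  have hBinv : ∀ i j, (↑B⁻¹ : Matrix n n K) i j = (b j : n → K) i := by
    intro i j
    rw [← hb']
    rfl
  have hB : ∀ x ∈ L, ∀ i, (B : Matrix n n K).mulVec x i ∈ (algebraMap R K).range := by
    intro x hx i
    have h1 : x = (↑B⁻¹ : Matrix n n K).mulVec
        fun j => algebraMap R K (b.repr ⟨x, hx⟩ j) := by
      funext k
      have h2 : ((∑ j, b.repr ⟨x, hx⟩ j • b j : L) : n → K) k = x k := by rw [b.sum_repr]
      simp only [Matrix.mulVec, dotProduct, hBinv]
      rw [← h2, Submodule.coe_sum, Finset.sum_apply]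
      refine Finset.sum_congr rfl fun l _ => ?_
      rw [Submodule.coe_smul, Pi.smul_apply, Algebra.smul_def, mul_comm]
    rw [h1, Matrix.mulVec_mulVec, ← Units.val_mul, mul_inv_cancel, Units.val_one,
      Matrix.one_mulVec]
    exact ⟨_, rfl⟩
  obtain ⟨a, ha0, ha1, ha, haq⟩ := exists_mul_mem_integers p fun q : n × n =>
      (A : Matrix n n (p.adicCompletion K)) q.1 q.2
  have hsingle : ∀ j, Pi.single j a ∈ L := single_mem_gluedLattice (fun i j => ha (i, j)) haq
  have hBa : ∀ i j, (B : Matrix n n K) i j * a ∈ (algebraMap R K).range := by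
    intro i j
    have h1 := hB _ (hsingle j) i
    rw [Matrix.mulVec_single] at h1
    simpa using! h1
  refine ⟨B, fun k j => ⟨?_, ?_⟩, fun q hq i j => ⟨?_, ?_⟩⟩
  -- Column `j` of `A⁻¹` is approximated modulo `a` by a vector `x` over `K`. Since `a A` is
  -- integral, `x` lies in the lattice and `B x` is integral; the error is harmless because `a B`
  -- has entries in `R`.
  · set i := algebraMap K (p.adicCompletion K) with hi
    choose x hx hxq using fun l => exists_valued_sub_le p
      ((↑A⁻¹ : Matrix n n (p.adicCompletion K)) l j) ha0 ha1
    have ha' : i a ≠ 0 := by simp [ha0]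
    let e : n → p.adicCompletion K := fun l =>
      (i (x l) - (↑A⁻¹ : Matrix n n (p.adicCompletion K)) l j) * (i a)⁻¹
    have he : ∀ l, e l ∈ p.adicCompletionIntegers K := by
      intro l
      rw [HeightOneSpectrum.mem_adicCompletionIntegers, map_mul, map_inv₀, valued_algebraMap,
        mul_inv_le_iff₀ (zero_lt_iff.2 ((Valuation.ne_zero_iff _).2 ha0)), one_mul]
      exact hx l
    have hxe : ∀ l, i (x l) = (↑A⁻¹ : Matrix n n (p.adicCompletion K)) l j + i a * e l := by
      intro l
      simp only [e]
      field_simp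
      ring
    have hxL : x ∈ L := by
      refine ⟨fun m => ?_, fun q hq l => hxq l q hq⟩
      have h1 : (A : Matrix n n (p.adicCompletion K)).mulVec (fun l => i (x l)) m =
          ((A : Matrix n n (p.adicCompletion K)) * (↑A⁻¹ : Matrix n n (p.adicCompletion K))) m j +
          ∑ l, i a * (A : Matrix n n (p.adicCompletion K)) m l * e l := by
        simp only [Matrix.mulVec, dotProduct, hxe, mul_add, Finset.sum_add_distrib,
          Matrix.mul_apply]
        congr 1
        exact Finset.sum_congr rfl fun l _ => by ring
      rw [h1, ← Units.val_mul, mul_inv_cancel, Units.val_one]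
      refine add_mem ?_ (sum_mem fun l _ => mul_mem (ha (m, l)) (he l))
      rw [Matrix.one_apply]
      split_ifs
      · exact one_mem _
      · exact zero_mem _
    have h2 : ((Matrix.GeneralLinearGroup.map i B * A⁻¹ : GL n (p.adicCompletion K)) :
        Matrix n n (p.adicCompletion K)) k j =
        i ((B : Matrix n n K).mulVec x k) - ∑ l, i ((B : Matrix n n K) k l * a) * e l := by
      rw [eq_sub_iff_add_eq, Units.val_mul, Matrix.mul_apply]
      simp only [Matrix.mulVec, dotProduct, map_sum, map_mul, hxe, ← Finset.sum_add_distrib]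
      refine Finset.sum_congr rfl fun l _ => ?_
      rw [Matrix.GeneralLinearGroup.map_apply]
      ring
    rw [h2]
    have hint : ∀ y ∈ (algebraMap R K).range, i y ∈ p.adicCompletionIntegers K := by
      rintro _ ⟨r, rfl⟩
      exact (algebraMap_mem_adicCompletionIntegers_iff p _).2 (p.valuation_le_one r)
    exact sub_mem (hint _ (hB x hxL k)) (sum_mem fun l _ => mul_mem (hint _ (hBa k l)) (he l))
  -- The columns of `A B⁻¹` are the images under `A` of the basis vectors of the lattice.
  · rw [mul_inv_rev, inv_inv, ← map_inv, Units.val_mul, Matrix.mul_apply]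
    have h1 := (b j).2.1 k
    rw [Matrix.mulVec, dotProduct] at h1
    convert h1 using 1
    refine Finset.sum_congr rfl fun l _ => ?_
    rw [Matrix.GeneralLinearGroup.map_apply, hBinv]
  -- At `𝔮 ≠ 𝔭`, `a` is a unit, so integrality of `B` follows from that of `a B`.
  · rw [Matrix.GeneralLinearGroup.map_apply, algebraMap_mem_adicCompletionIntegers_iff]
    obtain ⟨r, hr⟩ := hBa i j
    have h1 : q.valuation K (algebraMap R K r) ≤ 1 := q.valuation_le_one r
    rwa [hr, map_mul, haq q hq, mul_one] at h1
  · rw [← map_inv, Matrix.GeneralLinearGroup.map_apply, hBinv,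
      algebraMap_mem_adicCompletionIntegers_iff]
    exact (b j).2.2 q hq i

end Gluing

/-! ### Uniqueness of lifts, and the action on models -/

section Lifts

variable {F : Type*} [Field F] {N d : ℕ}

theorem evalMap_C_mul (c : F) (Φ : Fin (N + 1) → MvPolynomial (Fin (N + 1)) F)
    (a : Fin (N + 1) → AlgebraicClosure F) :
    evalMap (fun i => C c * Φ i) a = algebraMap F (AlgebraicClosure F) c • evalMap Φ a := by
  funext i
  simp [evalMap]

theorem IsLift.C_mul {φ : ProjMorphism F N d}
    {Φ : Fin (N + 1) → MvPolynomial (Fin (N + 1)) F} (h : IsLift Φ φ) {c : F} (hc : c ≠ 0) :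
    IsLift (fun i => C c * Φ i) φ := by
  have hc' : algebraMap F (AlgebraicClosure F) c ≠ 0 := by simpa using hc
  have hn : ∀ a, a ≠ 0 → evalMap (fun i => C c * Φ i) a ≠ 0 := by
    intro a ha
    rw [evalMap_C_mul]
    exact smul_ne_zero hc' (h.ne_zero a ha)
  refine ⟨⟨fun i => (h.homogeneous i).C_mul c, hn⟩, fun a ha => ?_⟩
  rw [h.apply_mk a ha, Projectivization.mk_eq_mk_iff']
  refine ⟨(algebraMap F (AlgebraicClosure F) c)⁻¹, ?_⟩
  rw [evalMap_C_mul, inv_smul_smul₀ hc']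

/-- The identity holds at every nonzero geometric point by proportionality of the values. At the
origin both sides vanish because `d ≥ 1`. -/
theorem Represents.mul_eq_mul (hd : 1 ≤ d) {Φ Φ' : Fin (N + 1) → MvPolynomial (Fin (N + 1)) F}
    {f : Points F N → Points F N} (h : Represents d Φ f) (h' : Represents d Φ' f)
    (i j : Fin (N + 1)) : Φ i * Φ' j = Φ j * Φ' i := by
  refine MvPolynomial.map_injective _ (algebraMap F (AlgebraicClosure F)).injective ?_
  refine MvPolynomial.funext fun a => ?_
  simp only [eval_map, ← aeval_def, map_mul]
  rcases eq_or_ne a 0 with rfl | ha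
  · have hz : ∀ i, aeval (0 : Fin (N + 1) → AlgebraicClosure F) (Φ i) = 0 := by
      intro i
      have := congrFun (evalMap_smul h.homogeneous 0 0) i
      simpa [evalMap, (Nat.one_le_iff_ne_zero.1 hd)] using this
    rw [hz i, hz j, zero_mul, zero_mul]
  · have h1 := (h'.apply_mk a ha).symm.trans (h.apply_mk a ha)
    rw [Projectivization.mk_eq_mk_iff'] at h1
    obtain ⟨c, hc1⟩ := h1
    have h2 : ∀ i, c * aeval a (Φ i) = aeval a (Φ' i) := fun i => congrFun hc1 i
    rw [← h2 i, ← h2 j]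
    ring

theorem IsNonvanishing.exists_X_pow_mem {Φ : Fin (N + 1) → MvPolynomial (Fin (N + 1)) F}
    (h : IsNonvanishing d Φ) (k : Fin (N + 1)) : ∃ m, X k ^ m ∈ Ideal.span (Set.range Φ) := by
  change X k ∈ (Ideal.span (Set.range Φ)).radical
  rw [← vanishingIdeal_zeroLocus_eq_radical (K := AlgebraicClosure F), mem_vanishingIdeal_iff]
  intro x hx
  have h0 : x = 0 := by
    by_contra hx0
    refine h.ne_zero x hx0 ?_
    funext i
    exact hx _ (Ideal.subset_span ⟨i, rfl⟩)
  simp [h0]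

/-- Two lifts of a morphism are proportional. -/
theorem Represents.exists_eq_C_mul (hN : 1 ≤ N) (hd : 1 ≤ d)
    {Φ Φ' : Fin (N + 1) → MvPolynomial (Fin (N + 1)) F} {f : Points F N → Points F N}
    (h : Represents d Φ f) (h' : Represents d Φ' f) :
    ∃ c : F, c ≠ 0 ∧ Φ' = fun i => C c * Φ i := by
  have hmul := h.mul_eq_mul hd h'
  have hne : ∀ {Θ : Fin (N + 1) → MvPolynomial (Fin (N + 1)) F}, Represents d Θ f →
      ∃ i, Θ i ≠ 0 := by
    intro Θ hΘ
    by_contra! h0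
    refine hΘ.ne_zero 1 one_ne_zero ?_
    funext i
    simp [evalMap, h0 i]
  obtain ⟨i, hi⟩ := hne h
  -- By the Nullstellensatz a power of `X k` is a combination of the `Φ j`, and `Φ' i * Φ j = Φ i *
  -- Φ' j`.
  have hdvd : ∀ k, ∃ m, Φ i ∣ Φ' i * X k ^ m := by
    intro k
    obtain ⟨m, hm⟩ := h.exists_X_pow_mem k
    obtain ⟨g, hg⟩ := Ideal.mem_span_range_iff_exists_fun.1 hm
    refine ⟨m, ?_⟩
    rw [← hg, Finset.mul_sum]
    refine Finset.dvd_sum fun j _ => ⟨g j * Φ' j, ?_⟩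
    linear_combination (-g j) * hmul i j
  have h01 : (0 : Fin (N + 1)) ≠ Fin.last N := by
    intro h01
    have := congrArg Fin.val h01
    simp at this
    omega
  -- Two distinct variables, available since `N ≥ 1`, are coprime, so their powers can be removed
  -- and `Φ i` divides `Φ' i`. As the degrees agree, the quotient is a constant.
  obtain ⟨m, s, hs⟩ := hdvd 0
  obtain ⟨m', t, ht⟩ := hdvd (Fin.last N)
  have hX : ¬ (X 0 : MvPolynomial (Fin (N + 1)) F) ∣ X (Fin.last N) ^ m' := by
    intro hX
    exact h01 (X_dvd_X.1 ((X_prime (i := (0 : Fin (N + 1)))).dvd_of_dvd_pow hX))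
  have hst : s * X (Fin.last N) ^ m' = t * X 0 ^ m := by
    refine mul_left_cancel₀ hi ?_
    linear_combination (-X (Fin.last N) ^ m') * hs + X 0 ^ m * ht
  obtain ⟨s', hs'⟩ := (X_prime (i := (0 : Fin (N + 1)))).pow_dvd_of_dvd_mul_right m hX
    ⟨t, hst.trans (mul_comm _ _)⟩
  have hq : Φ' i = Φ i * s' := by
    refine mul_right_cancel₀ (pow_ne_zero m (X_ne_zero (R := F) (0 : Fin (N + 1)))) ?_
    rw [hs, hs']
    ring
  have hi' : Φ' i ≠ 0 := by
    intro h0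
    obtain ⟨j, hj⟩ := hne h'
    have h1 := hmul i j
    rw [h0, mul_zero] at h1
    exact (mul_ne_zero hi hj) h1
  have hs0 : s' ≠ 0 := by
    rintro rfl
    exact hi' (by rw [hq, mul_zero])
  have hdeg : s'.totalDegree = 0 := by
    have h1 := totalDegree_mul_of_isDomain hi hs0
    rw [← hq, (h'.homogeneous i).totalDegree hi', (h.homogeneous i).totalDegree hi] at h1
    omega
  obtain ⟨c, hc⟩ : ∃ c, s' = C c := ⟨_, totalDegree_eq_zero_iff_eq_C.1 hdeg⟩
  refine ⟨c, ?_, ?_⟩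
  · rintro rfl
    exact hs0 (by rw [hc, C_0])
  · funext j
    refine mul_left_cancel₀ hi ?_
    rw [hmul i j, hq, hc]
    ring

theorem conj_eq_act (A : GL (Fin (N + 1)) F) (Φ : Fin (N + 1) → MvPolynomial (Fin (N + 1)) F) :
    conj A Φ = act (A : Matrix _ _ F) (↑A⁻¹ : Matrix _ _ F) Φ :=
  rfl

/-- Scalars are absorbed into the left matrix, so that every change of model is a single `act` and
composes by `act_act`. -/
theorem C_mul_eq_act {S : Type*} [CommRing S] (c : S)
    {Φ : Fin (N + 1) → MvPolynomial (Fin (N + 1)) S} (h : ∀ i, (Φ i).IsHomogeneous d) :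
    (fun i => C c * Φ i) = act (c • 1) 1 Φ := by
  have := act_smul_one c 1 h
  rw [one_pow, mul_one, one_smul] at this
  exact this.symm

theorem IsModel.isHomogeneous {φ : ProjMorphism F N d}
    {Ψ : Fin (N + 1) → MvPolynomial (Fin (N + 1)) F} (h : IsModel Ψ φ) (i : Fin (N + 1)) :
    (Ψ i).IsHomogeneous d := by
  obtain ⟨Φ, A, hΦ, rfl⟩ := h
  exact isHomogeneous_act _ _ hΦ.homogeneous i

theorem IsModel.smul_act {φ : ProjMorphism F N d}
    {Ψ : Fin (N + 1) → MvPolynomial (Fin (N + 1)) F} (h : IsModel Ψ φ) {c : F} (hc : c ≠ 0)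
    (B : GL (Fin (N + 1)) F) :
    IsModel (act (c • (B : Matrix _ _ F)) (↑B⁻¹ : Matrix _ _ F) Ψ) φ := by
  obtain ⟨Φ, A, hΦ, rfl⟩ := h
  refine ⟨_, B * A, hΦ.C_mul hc, ?_⟩
  rw [C_mul_eq_act c hΦ.homogeneous, conj_eq_act, conj_eq_act, act_act, act_act, mul_inv_rev,
    Units.val_mul, Units.val_mul, one_mul, mul_smul_comm, mul_one, smul_mul_assoc]

theorem mapForms_act {L : Type*} [Field L] [Algebra F L]
    (P Q : Matrix (Fin (N + 1)) (Fin (N + 1)) F)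
    (Φ : Fin (N + 1) → MvPolynomial (Fin (N + 1)) F) :
    mapForms L (act P Q Φ) =
      act (P.map (algebraMap F L)) (Q.map (algebraMap F L)) (mapForms L Φ) :=
  map_act (algebraMap F L) P Q Φ

theorem mapForms_conj {L : Type*} [Field L] [Algebra F L] (A : GL (Fin (N + 1)) F)
    (Φ : Fin (N + 1) → MvPolynomial (Fin (N + 1)) F) :
    mapForms L (conj A Φ) =
      conj (Matrix.GeneralLinearGroup.map (algebraMap F L) A) (mapForms L Φ) := by
  rw [conj_eq_act, conj_eq_act, mapForms_act, ← map_inv]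
  rfl

theorem IsModel.baseChange {L : Type*} [Field L] [Algebra F L] {φ : ProjMorphism F N d}
    {Ψ : Fin (N + 1) → MvPolynomial (Fin (N + 1)) F} (h : IsModel Ψ φ) :
    IsModel (mapForms L Ψ) (φ.baseChange L) := by
  obtain ⟨Φ, A, hΦ, rfl⟩ := h
  exact ⟨_, _, hΦ.baseChange, mapForms_conj A Φ⟩

/-- Two models of a morphism differ by the action of a matrix and a scalar. -/
theorem IsModel.exists_eq_smul_act (hN : 1 ≤ N) (hd : 1 ≤ d) {φ : ProjMorphism F N d}
    {Ψ Ψ' : Fin (N + 1) → MvPolynomial (Fin (N + 1)) F} (h : IsModel Ψ φ) (h' : IsModel Ψ' φ) :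
    ∃ (c : F) (A : GL (Fin (N + 1)) F), c ≠ 0 ∧
      Ψ' = act (c • (A : Matrix _ _ F)) (↑A⁻¹ : Matrix _ _ F) Ψ := by
  obtain ⟨Φ, A, hΦ, rfl⟩ := h
  obtain ⟨Φ', A', hΦ', rfl⟩ := h'
  obtain ⟨c, hc, rfl⟩ := Represents.exists_eq_C_mul hN hd hΦ hΦ'
  refine ⟨c, A' * A⁻¹, hc, ?_⟩
  rw [C_mul_eq_act c hΦ.homogeneous, conj_eq_act, conj_eq_act, act_act, act_act, smul_mul_assoc,
    ← Units.val_mul, ← Units.val_mul, inv_mul_cancel_right, mul_inv_rev, inv_inv,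
    inv_mul_cancel_left, one_mul, mul_smul_comm, mul_one]

end Lifts

/-! ### Orders of resultants, and replacing a global model at one prime -/

section Local

open IsDedekindDomain

variable {R : Type*} [CommRing R] [IsDomain R] [IsPrincipalIdealRing R]
  {K : Type*} [Field K] [Algebra R K] [IsFractionRing R K] {N d : ℕ}

theorem exists_map_eq_of_coeff_mem {S : Type*} [CommRing S] {S' : Type*} [CommRing S']
    (θ : S →+* S') {Ψ : Fin (N + 1) → MvPolynomial (Fin (N + 1)) S'}
    (h : ∀ i m, coeff m (Ψ i) ∈ θ.range) :
    ∃ Ψ₀ : Fin (N + 1) → MvPolynomial (Fin (N + 1)) S,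
      Ψ = fun i => MvPolynomial.map θ (Ψ₀ i) := by
  have h1 : ∀ i, ∃ p, MvPolynomial.map θ p = Ψ i := by
    intro i
    have : Ψ i ∈ (MvPolynomial.map θ).range := by
      rw [← SetLike.mem_coe, RingHom.coe_range, mem_range_map_iff_coeffs_subset]
      intro x hx
      obtain ⟨m, -, rfl⟩ := mem_coeffs_iff.1 hx
      exact h i m
    exact this
  choose Ψ₀ hΨ₀ using h1
  exact ⟨Ψ₀, (_root_.funext hΨ₀).symm⟩

/-- All the data descend to the ring of integers, where the determinants of `P` and `Q` are units.
There the universal divisibility says that the new resultant divides the old one. -/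
theorem integral_act_and_resultant_le (p : HeightOneSpectrum R)
    {P Q P' Q' : Matrix (Fin (N + 1)) (Fin (N + 1)) (p.adicCompletion K)}
    (hPP' : P * P' = 1) (hQQ' : Q * Q' = 1)
    (hP : ∀ i j, P i j ∈ p.adicCompletionIntegers K)
    (hQ : ∀ i j, Q i j ∈ p.adicCompletionIntegers K)
    (hP' : ∀ i j, P' i j ∈ p.adicCompletionIntegers K)
    (hQ' : ∀ i j, Q' i j ∈ p.adicCompletionIntegers K)
    {Ψ : Fin (N + 1) → MvPolynomial (Fin (N + 1)) (p.adicCompletion K)}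
    (hom : ∀ i, (Ψ i).IsHomogeneous d)
    (hΨ : ∀ i m, coeff m (Ψ i) ∈ p.adicCompletionIntegers K) :
    (∀ i m, coeff m (act P Q Ψ i) ∈ p.adicCompletionIntegers K) ∧
      Valued.v (resultant d Ψ) ≤ Valued.v (resultant d (act P Q Ψ)) := by
  let O := p.adicCompletionIntegers K
  let θ : O →+* p.adicCompletion K := O.subtype
  have hlift : ∀ M : Matrix (Fin (N + 1)) (Fin (N + 1)) (p.adicCompletion K),
      (∀ i j, M i j ∈ O) → ∃ M₀ : Matrix (Fin (N + 1)) (Fin (N + 1)) O, M₀.map θ = M :=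
    fun M hM => ⟨Matrix.of fun i j => ⟨M i j, hM i j⟩, rfl⟩
  have hθ : Function.Injective θ := Subtype.val_injective
  obtain ⟨P₀, rfl⟩ := hlift P hP
  obtain ⟨Q₀, rfl⟩ := hlift Q hQ
  obtain ⟨P₁, rfl⟩ := hlift P' hP'
  obtain ⟨Q₁, rfl⟩ := hlift Q' hQ'
  obtain ⟨Ψ₀, rfl⟩ := exists_map_eq_of_coeff_mem θ (Ψ := Ψ) fun i m => ⟨⟨_, hΨ i m⟩, rfl⟩
  have hdet : ∀ M M' : Matrix (Fin (N + 1)) (Fin (N + 1)) O, M.map θ * M'.map θ = 1 →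
      IsUnit M.det := by
    intro M M' h
    have h1 := congrArg Matrix.det h
    rw [Matrix.det_mul, Matrix.det_one] at h1
    change (θ.mapMatrix M).det * (θ.mapMatrix M').det = 1 at h1
    rw [← RingHom.map_det, ← RingHom.map_det, ← map_mul, ← map_one θ] at h1
    exact IsUnit.of_mul_eq_one _ (hθ h1)
  have hu : IsUnit (P₀.det * Q₀.det) := (hdet _ _ hPP').mul (hdet _ _ hQQ')
  rw [← map_act]
  refine ⟨fun i m => ?_, ?_⟩
  · rw [coeff_map]
    exact (coeff m (act P₀ Q₀ Ψ₀ i)).2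
  · obtain ⟨n, hn⟩ := exists_resultant_act_dvd P₀ Q₀ fun i => (hom i).of_map hθ
    rw [(hu.pow n).dvd_mul_left] at hn
    obtain ⟨g, hg⟩ := hn
    rw [resultant_map, resultant_map, hg, map_mul, map_mul]
    exact mul_le_of_le_one_right' g.2

theorem integral_act_and_resultant_eq (p : HeightOneSpectrum R)
    {P Q P' Q' : Matrix (Fin (N + 1)) (Fin (N + 1)) (p.adicCompletion K)}
    (hPP' : P * P' = 1) (hQQ' : Q * Q' = 1)
    (hP : ∀ i j, P i j ∈ p.adicCompletionIntegers K)
    (hQ : ∀ i j, Q i j ∈ p.adicCompletionIntegers K)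
    (hP' : ∀ i j, P' i j ∈ p.adicCompletionIntegers K)
    (hQ' : ∀ i j, Q' i j ∈ p.adicCompletionIntegers K)
    {Ψ : Fin (N + 1) → MvPolynomial (Fin (N + 1)) (p.adicCompletion K)}
    (hom : ∀ i, (Ψ i).IsHomogeneous d)
    (hΨ : ∀ i m, coeff m (Ψ i) ∈ p.adicCompletionIntegers K) :
    (∀ i m, coeff m (act P Q Ψ i) ∈ p.adicCompletionIntegers K) ∧
      Valued.v (resultant d (act P Q Ψ)) = Valued.v (resultant d Ψ) := by
  obtain ⟨h1, h2⟩ := integral_act_and_resultant_le p hPP' hQQ' hP hQ hP' hQ' hom hΨ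
  have hP'P : P' * P = 1 := mul_eq_one_comm.1 hPP'
  have hQ'Q : Q' * Q = 1 := mul_eq_one_comm.1 hQQ'
  obtain ⟨-, h3⟩ := integral_act_and_resultant_le p hP'P hQ'Q hP' hQ' hP hQ
    (isHomogeneous_act P Q hom) h1
  rw [act_act, hP'P, hQQ', act_one_one] at h3
  exact ⟨h1, le_antisymm h3 h2⟩

/-- The action of an integral matrix with integral inverse and of a scalar unit preserves
integrality and the valuation of the resultant. -/
theorem IsIntegralGL.act_smul {p : HeightOneSpectrum R} {U : GL (Fin (N + 1)) (p.adicCompletion K)}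
    (hU : IsIntegralGL p U) {c : p.adicCompletion K} (hc : Valued.v c = 1)
    {Ψ : Fin (N + 1) → MvPolynomial (Fin (N + 1)) (p.adicCompletion K)}
    (hom : ∀ i, (Ψ i).IsHomogeneous d)
    (hΨ : ∀ i m, coeff m (Ψ i) ∈ p.adicCompletionIntegers K) :
    (∀ i m, coeff m (act (c • (U : Matrix _ _ (p.adicCompletion K)))
        (↑U⁻¹ : Matrix _ _ (p.adicCompletion K)) Ψ i) ∈ p.adicCompletionIntegers K) ∧
      Valued.v (resultant d (act (c • (U : Matrix _ _ (p.adicCompletion K)))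
        (↑U⁻¹ : Matrix _ _ (p.adicCompletion K)) Ψ)) = Valued.v (resultant d Ψ) := by
  have hc0 : c ≠ 0 := by
    rintro rfl
    rw [map_zero] at hc
    exact zero_ne_one hc
  have hcm : c ∈ p.adicCompletionIntegers K := by
    rw [HeightOneSpectrum.mem_adicCompletionIntegers, hc]
  have hcm' : c⁻¹ ∈ p.adicCompletionIntegers K := by
    rw [HeightOneSpectrum.mem_adicCompletionIntegers, map_inv₀, hc, inv_one]
  have hQQ' : (↑U⁻¹ : Matrix (Fin (N + 1)) (Fin (N + 1)) (p.adicCompletion K)) *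
      (U : Matrix (Fin (N + 1)) (Fin (N + 1)) (p.adicCompletion K)) = 1 := by
    rw [← Units.val_mul, inv_mul_cancel, Units.val_one]
  have hPP' : (c • (U : Matrix (Fin (N + 1)) (Fin (N + 1)) (p.adicCompletion K))) *
      (c⁻¹ • (↑U⁻¹ : Matrix (Fin (N + 1)) (Fin (N + 1)) (p.adicCompletion K))) = 1 := by
    rw [smul_mul_smul_comm, mul_inv_cancel₀ hc0, one_smul, ← Units.val_mul, mul_inv_cancel,
      Units.val_one]
  have hP : ∀ i j, (c • (U : Matrix (Fin (N + 1)) (Fin (N + 1)) (p.adicCompletion K))) i j ∈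
      p.adicCompletionIntegers K := by
    intro i j
    rw [Matrix.smul_apply, smul_eq_mul]
    exact mul_mem hcm (hU i j).1
  have hP' : ∀ i j, (c⁻¹ • (↑U⁻¹ : Matrix (Fin (N + 1)) (Fin (N + 1)) (p.adicCompletion K))) i j ∈
      p.adicCompletionIntegers K := by
    intro i j
    rw [Matrix.smul_apply, smul_eq_mul]
    exact mul_mem hcm' (hU i j).2
  exact integral_act_and_resultant_eq p hPP' hQQ' hP (fun i j => (hU i j).2) hP'
    (fun i j => (hU i j).1) hom hΨ

theorem exists_global_scalar (p : HeightOneSpectrum R) {c : p.adicCompletion K} (hc : c ≠ 0) :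
    ∃ a : K, a ≠ 0 ∧ p.valuation K a = Valued.v c ∧ ∀ q ≠ p, q.valuation K a = 1 := by
  obtain ⟨π, hπ, hπ'⟩ := exists_eq_exp_neg_one (K := K) p
  have hc' : Valued.v c ≠ 0 := (Valuation.ne_zero_iff _).2 hc
  have h1 : p.valuation K (π ^ (-WithZero.log (Valued.v c))) = Valued.v c := by
    rw [map_zpow₀, hπ, ← WithZero.exp_zsmul, smul_eq_mul, neg_mul_neg, mul_one,
      WithZero.exp_log hc']
  refine ⟨π ^ (-WithZero.log (Valued.v c)), ?_, h1, fun q hq => ?_⟩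
  · rw [← Valuation.ne_zero_iff (p.valuation K), h1]
    exact hc'
  · rw [map_zpow₀, hπ' q hq, one_zpow]

theorem valued_resultant_mapForms (p : HeightOneSpectrum R)
    (Ψ : Fin (N + 1) → MvPolynomial (Fin (N + 1)) K) :
    Valued.v (resultant d (mapForms (p.adicCompletion K) Ψ)) =
      p.valuation K (resultant d Ψ) := by
  rw [← valued_algebraMap, ← resultant_map]
  rfl

/-- A global integral model can be replaced by one that is locally equivalent to a given integral
model at one prime, and to the given global model at the other primes. -/
theorem exists_model_of_local_model (hN : 1 ≤ N) (hd : 1 ≤ d) {φ : ProjMorphism K N d}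
    {Ψ : Fin (N + 1) → MvPolynomial (Fin (N + 1)) K} (h : IsModel Ψ φ)
    (hint : ∀ (q : HeightOneSpectrum R) i m, q.valuation K (coeff m (Ψ i)) ≤ 1)
    (p : HeightOneSpectrum R)
    {Ψ' : Fin (N + 1) → MvPolynomial (Fin (N + 1)) (p.adicCompletion K)}
    (h' : IsIntegralModel p Ψ' (φ.baseChange (p.adicCompletion K))) :
    ∃ Θ : Fin (N + 1) → MvPolynomial (Fin (N + 1)) K, IsModel Θ φ ∧
      (∀ (q : HeightOneSpectrum R) i m, q.valuation K (coeff m (Θ i)) ≤ 1) ∧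
      p.valuation K (resultant d Θ) = Valued.v (resultant d Ψ') ∧
      ∀ q ≠ p, q.valuation K (resultant d Θ) = q.valuation K (resultant d Ψ) := by
  -- The new model is `a · B ∘ Ψ ∘ B⁻¹`. At `𝔭` it arises from `Ψ'` through `B A⁻¹` and the unit `a
  -- / c`; at the other primes it arises from `Ψ` through `B` and the unit `a`.
  obtain ⟨c, A, hc, hA⟩ := h.baseChange.exists_eq_smul_act hN hd h'.1
  obtain ⟨B, hBp, hBq⟩ := exists_global_matrix p A
  obtain ⟨a, ha0, hap, haq⟩ := exists_global_scalar p hc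
  have hmap : ∀ q : HeightOneSpectrum R,
      mapForms (q.adicCompletion K) (act (a • (B : Matrix _ _ K)) (↑B⁻¹ : Matrix _ _ K) Ψ) =
        act (algebraMap K (q.adicCompletion K) a •
            (Matrix.GeneralLinearGroup.map (algebraMap K (q.adicCompletion K)) B :
              Matrix _ _ (q.adicCompletion K)))
          (↑(Matrix.GeneralLinearGroup.map (algebraMap K (q.adicCompletion K)) B)⁻¹ :
              Matrix _ _ (q.adicCompletion K)) (mapForms (q.adicCompletion K) Ψ) := by
    intro q
    rw [mapForms_act, ← map_inv]
    congr 1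
    ext i j
    simp
  have hp : mapForms (p.adicCompletion K)
      (act (a • (B : Matrix _ _ K)) (↑B⁻¹ : Matrix _ _ K) Ψ) =
        act ((algebraMap K (p.adicCompletion K) a * c⁻¹) •
            (↑(Matrix.GeneralLinearGroup.map (algebraMap K (p.adicCompletion K)) B * A⁻¹) :
              Matrix _ _ (p.adicCompletion K)))
          (↑(Matrix.GeneralLinearGroup.map (algebraMap K (p.adicCompletion K)) B * A⁻¹)⁻¹ :
              Matrix _ _ (p.adicCompletion K)) Ψ' := by
    rw [hmap, hA, act_act, smul_mul_smul_comm, ← Units.val_mul, ← Units.val_mul,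
      inv_mul_cancel_right, inv_mul_cancel_right₀ hc, mul_inv_rev, inv_inv,
      inv_mul_cancel_left]
  have hunit : Valued.v (algebraMap K (p.adicCompletion K) a * c⁻¹) = 1 := by
    rw [map_mul, map_inv₀, valued_algebraMap, hap,
      mul_inv_cancel₀ ((Valuation.ne_zero_iff _).2 hc)]
  have hresp := hBp.act_smul hunit h'.1.isHomogeneous h'.2
  rw [← hp] at hresp
  have hresq : ∀ q ≠ p, _ := fun q hq => (hBq q hq).act_smul
    (c := algebraMap K (q.adicCompletion K) a) (by rw [valued_algebraMap, haq q hq])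
    (h.baseChange (L := q.adicCompletion K)).isHomogeneous fun i m => by
      rw [mapForms, coeff_map, algebraMap_mem_adicCompletionIntegers_iff]
      exact hint q i m
  refine ⟨_, h.smul_act ha0 B, fun q i m => ?_, ?_, fun q hq => ?_⟩
  · rw [← algebraMap_mem_adicCompletionIntegers_iff, ← coeff_map]
    rcases eq_or_ne q p with rfl | hq
    · exact hresp.1 i m
    · have h1 := (hresq q hq).1 i m
      rwa [← hmap] at h1
  · rw [← valued_resultant_mapForms]
    exact hresp.2
  · have h1 := (hresq q hq).2
    rwa [← hmap, valued_resultant_mapForms, valued_resultant_mapForms] at h1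

end Local

/-! ### Existence of a model over `R` -/

section IntegralModel

variable {R : Type*} [CommRing R] [IsDomain R] {K : Type*} [Field K] [Algebra R K]
  [IsFractionRing R K] {N d : ℕ}

theorem exists_integral_model (φ : ProjMorphism K N d) :
    ∃ Ψ : Fin (N + 1) → MvPolynomial (Fin (N + 1)) R,
      IsModel (fun i => MvPolynomial.map (algebraMap R K) (Ψ i)) φ := by
  obtain ⟨Φ, hΦ⟩ := φ.exists_lift
  obtain ⟨b, hb⟩ := IsLocalization.exist_integer_multiples (nonZeroDivisors R)
    (Finset.univ.sigma fun i => (Φ i).support) fun q => coeff q.2 (Φ q.1)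
  have hb0 : algebraMap R K b ≠ 0 :=
    IsLocalization.to_map_ne_zero_of_mem_nonZeroDivisors K le_rfl b.2
  have hΦ' : IsLift (fun i => C (algebraMap R K b) * Φ i) φ := IsLift.C_mul hΦ hb0
  obtain ⟨Ψ, hΨ⟩ := exists_map_eq_of_coeff_mem (algebraMap R K)
    (Ψ := fun i => C (algebraMap R K b) * Φ i) fun i m => by
      rw [coeff_C_mul]
      by_cases hm : m ∈ (Φ i).support
      · obtain ⟨r, hr⟩ := hb ⟨i, m⟩ (by simpa using! hm)
        exact ⟨r, by rw [hr, Algebra.smul_def]⟩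
      · rw [notMem_support_iff.1 hm, mul_zero]
        exact zero_mem _
  refine ⟨Ψ, _, 1, hΦ', ?_⟩
  rw [conj_eq_act, inv_one, Units.val_one, act_one_one, hΨ]

end IntegralModel

end GlobalMinimal

end

/-! ### The global minimal model -/

theorem theorem1 (R : Type*) [CommRing R] [IsDomain R] [IsPrincipalIdealRing R]
    (K : Type*) [Field K] [Algebra R K] [IsFractionRing R K]
    (N d : ℕ) (hN : 1 ≤ N) (hd : 1 ≤ d) (φ : GlobalMinimal.ProjMorphism K N d) :
    ∃ Ψ : Fin (N + 1) → MvPolynomial (Fin (N + 1)) K,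
      GlobalMinimal.IsModel Ψ φ ∧
      (∀ i m, MvPolynomial.coeff m (Ψ i) ∈ (algebraMap R K).range) ∧
      ∀ p : IsDedekindDomain.HeightOneSpectrum R,
        GlobalMinimal.IsMinimalModel p
          (GlobalMinimal.mapForms (p.adicCompletion K) Ψ)
          (φ.baseChange (p.adicCompletion K)) := by
  let S : Set (Ideal R) := {J | ∃ Ψ : Fin (N + 1) → MvPolynomial (Fin (N + 1)) R,
    GlobalMinimal.IsModel (fun i => MvPolynomial.map (algebraMap R K) (Ψ i)) φ ∧
      J = Ideal.span {GlobalMinimal.resultant d Ψ}}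
  have hS : S.Nonempty := by
    obtain ⟨Ψ, hΨ⟩ := GlobalMinimal.exists_integral_model (R := R) φ
    exact ⟨_, Ψ, hΨ, rfl⟩
  obtain ⟨_, ⟨Ψ, hΨ, rfl⟩, hmax⟩ :=
    (wellFounded_gt : WellFounded ((· > ·) : Ideal R → Ideal R → Prop)).has_min S hS
  have hint : ∀ (q : IsDedekindDomain.HeightOneSpectrum R) i m,
      q.valuation K (coeff m (MvPolynomial.map (algebraMap R K) (Ψ i))) ≤ 1 := by
    intro q i m
    rw [coeff_map]
    exact q.valuation_le_one _
  refine ⟨_, hΨ, fun i m => ⟨coeff m (Ψ i), (coeff_map _ _ _).symm⟩, fun p => ?_⟩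
  refine ⟨⟨hΨ.baseChange, fun i m => ?_⟩, fun Ψ' hΨ' => ?_⟩
  · rw [GlobalMinimal.mapForms, coeff_map,
      GlobalMinimal.algebraMap_mem_adicCompletionIntegers_iff]
    exact hint p i m
  by_contra! hlt
  obtain ⟨Θ, hΘ, hΘint, hΘp, hΘq⟩ :=
    GlobalMinimal.exists_model_of_local_model hN hd hΨ hint p hΨ'
  obtain ⟨Θ₀, rfl⟩ := GlobalMinimal.exists_map_eq_of_coeff_mem (algebraMap R K) (Ψ := Θ)
    fun i m => IsDedekindDomain.HeightOneSpectrum.mem_integers_of_valuation_le_one K _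
      fun q => hΘint q i m
  rw [GlobalMinimal.valued_resultant_mapForms, ← hΘp, GlobalMinimal.resultant_map,
    GlobalMinimal.resultant_map] at hlt
  simp only [GlobalMinimal.resultant_map] at hΘq
  set r := GlobalMinimal.resultant d Ψ with hr
  set s := GlobalMinimal.resultant d Θ₀ with hs
  -- The strict inequality at `p` already forces `s ≠ 0`; nonvanishing of resultants of models is
  -- not needed.
  have hs0 : algebraMap R K s ≠ 0 := by
    intro h0
    rw [h0, map_zero] at hlt
    exact not_lt_zero hlt
  -- The quotient `r / s` is integral at `p` by the strict inequality, and at the other primes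
  -- because the valuations agree. Hence `s` divides `r` in `R`, and properly so, against the
  -- maximality of `(r)`.
  obtain ⟨t, ht⟩ := IsDedekindDomain.HeightOneSpectrum.mem_integers_of_valuation_le_one (R := R) K
    (algebraMap R K r / algebraMap R K s) fun q => by
      have hq0 : q.valuation K (algebraMap R K s) ≠ 0 := (Valuation.ne_zero_iff _).2 hs0
      rw [map_div₀]
      refine div_le_one_of_le₀ ?_ zero_le
      rcases eq_or_ne q p with rfl | hq
      · exact hlt.le
      · exact (hΘq q hq).ge
  have hrs : r = s * t := by
    refine IsFractionRing.injective R K ?_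
    rw [map_mul, ht]
    field_simp
  refine hmax _ ⟨Θ₀, hΘ, rfl⟩ (lt_of_le_not_ge ?_ fun hle => ?_)
  · exact Ideal.span_singleton_le_span_singleton.2 ⟨t, hrs⟩
  · obtain ⟨u, hu⟩ := Ideal.span_singleton_le_span_singleton.1 hle
    refine hlt.not_ge ?_
    rw [show s = r * u from hu, map_mul, map_mul]
    exact mul_le_of_le_one_right' (p.valuation_le_one u)
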